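/- Consider a fluid polling model with two queues and one server. Fluid enters each queue at constant rate $\lambda>0$. The server stays alternately at queue 1 and at queue 2, for independent exponentially distributed times of rate $c>0$ which do not depend on the workloads. While the server is at a queue, that queue is drained at rate $\mu>0$ (net rate $\lambda-\mu$) as long as it is nonempty and stays at $0$ once it is empty; the workload of the other queue grows at rate $\lambda$. Fix $c$ and $\mu$, let $\rho=\lambda/\mu\in(0,1/2)$, and let $(V_1,V_2)$ be the pair of workloads in stationarity, either at the beginning of a cycle (the epochs at which the server arrives at queue 1) or at an arbitrary epoch. Stationarity at the beginning of a cycle means: if the workloads at time $0$ have the law of $(V_1,V_2)$, the visit times $T_1$ (to queue 1, starting at time $0$) and $T_2$ (to queue 2) are exponentially distributed of rate $c$, and these are all independent, then the workloads at time $T_1+T_2$ have again the law of $(V_1,V_2)$. The law at an arbitrary epoch is then $A\mapsto\mathbb E\big[\int_0^{T_1+T_2}1_A(V_1(t),V_2(t))\,dt\big]/\mathbb E[T_1+T_2]$. For each $\rho\in(0,1/2)$ the scaled total workload $(\tfrac12-\rho)(V_1+V_2)$ has a probability density function $f_\rho$ that is continuous on $(0,\infty)$, and $$\lim_{\rho\uparrow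 1/2} f_\rho(x)=\sum_{n=1}^\infty(-1)^{n+1}(2n+1)\,\frac c\mu\big((2n+1)^2-1\big)\,e^{-\frac c\mu((2n+1)^2-1)x},\qquad x>0,$$ where the series converges absolutely. Moreover, as $\rho\uparrow 1/2$, the scaled total workload converges in distribution; the limiting distribution is concentrated on $(0,\infty)$ with the right-hand side above as its (nonnegative) density, it is infinitely divisible, and it is the distribution of the almost surely convergent series $$\sum_{n=1}^\infty\frac{\mathcal E_n}{\frac c\mu\big((2n+1)^2-1\big)},$$ where $\mathcal E_1,\mathcal E_2,\dots$ are independent exponentially distributed random variables of rate $1$. -/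

import Mathlib

open MeasureTheory ProbabilityTheory Filter Topology Set

noncomputable section

namespace FluidPolling

/-- The two workloads `t` time units after the server starts a visit to queue 1 with
workloads `v`, as long as the visit lasts: fluid enters both queues at rate `lam`, and queue 1
is drained at rate `mu` while it is nonempty. -/
def serveFirst (lam mu : ℝ) (v : ℝ × ℝ) (t : ℝ) : ℝ × ℝ :=
  (max 0 (v.1 + (lam - mu) * t), v.2 + lam * t)

/-- The two workloads `t` time units after the server starts a visit to queue 2 with
workloads `v`, as long as the visit lasts. -/
def serveSecond (lam mu : ℝ) (v : ℝ × ℝ) (t : ℝ) : ℝ × ℝ :=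
  (v.1 + lam * t, max 0 (v.2 + (lam - mu) * t))

/-- The data of one cycle: the workloads at its beginning (the server arrives at queue 1), and
the lengths `T₁`, `T₂` of the visit to queue 1 and of the subsequent visit to queue 2. -/
abbrev Cycle : Type := (ℝ × ℝ) × (ℝ × ℝ)

/-- The workloads at time `t ∈ [0, T₁ + T₂]` of a cycle. -/
def workloadAt (lam mu : ℝ) (ω : Cycle) (t : ℝ) : ℝ × ℝ :=
  if t ≤ ω.2.1 then serveFirst lam mu ω.1 t
  else serveSecond lam mu (serveFirst lam mu ω.1 ω.2.1) (t - ω.2.1)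

/-- The law of a cycle that begins with workloads of law `ν`: the visit times are exponential
of rate `c`, independent of each other and of the workloads at the beginning. -/
def cycleLaw (c : ℝ) (ν : Measure (ℝ × ℝ)) : Measure Cycle :=
  ν.prod ((expMeasure c).prod (expMeasure c))

/-- `ν` is a stationary law of the workloads at the beginnings of cycles:
`(V₁(T₁ + T₂), V₂(T₁ + T₂))` has the law of `(V₁(0), V₂(0))`. -/
structure IsCycleStationary (c lam mu : ℝ) (ν : Measure (ℝ × ℝ)) : Prop where
  prob : IsProbabilityMeasure ν
  nonneg : ∀ᵐ v ∂ν, 0 ≤ v.1 ∧ 0 ≤ v.2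
  invariant :
    Measure.map (fun ω : Cycle => workloadAt lam mu ω (ω.2.1 + ω.2.2)) (cycleLaw c ν) = ν

/-- The stationary law of the workloads at an arbitrary epoch, `ν` being that at the beginning
of a cycle: `A ↦ E[∫₀^{T₁+T₂} 1_A(V(t)) dt] / E[T₁ + T₂]`, where `E[T₁ + T₂] = 2 / c`. -/
def arbitraryEpochLaw (c lam mu : ℝ) (ν : Measure (ℝ × ℝ)) : Measure (ℝ × ℝ) :=
  ENNReal.ofReal (c / 2) •
    Measure.map (fun p : Cycle × ℝ => workloadAt lam mu p.1 p.2)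
      (((cycleLaw c ν).prod volume).restrict
        {p : Cycle × ℝ | 0 ≤ p.2 ∧ p.2 ≤ p.1.2.1 + p.1.2.2})

/-- The measure is a law of the pair `(V₁, V₂)` of workloads in stationarity, observed either at
the beginning of a cycle or at an arbitrary epoch. -/
inductive IsStationaryWorkloadLaw (c lam mu : ℝ) : Measure (ℝ × ℝ) → Prop
  | cycleStart (ν : Measure (ℝ × ℝ)) (h : IsCycleStationary c lam mu ν) :
      IsStationaryWorkloadLaw c lam mu ν
  | arbitraryEpoch (ν : Measure (ℝ × ℝ)) (h : IsCycleStationary c lam mu ν) :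
      IsStationaryWorkloadLaw c lam mu (arbitraryEpochLaw c lam mu ν)

/-- The law of the scaled total workload `(1/2 - ρ)(V₁ + V₂)`, `V` being the law of
`(V₁, V₂)`. -/
def scaledTotalLaw (rho : ℝ) (V : Measure (ℝ × ℝ)) : Measure ℝ :=
  Measure.map (fun v : ℝ × ℝ => (1 / 2 - rho) * (v.1 + v.2)) V

/-- `(c/μ)((2n+1)² - 1)`. -/
def limitRate (c mu : ℝ) (n : ℕ) : ℝ := c / mu * ((2 * (n : ℝ) + 1) ^ 2 - 1)

/-- The `n`-th term of the limiting density at `x`, `n ≥ 1`. -/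
def densityTerm (c mu x : ℝ) (n : ℕ) : ℝ :=
  (-1) ^ (n + 1) * (2 * (n : ℝ) + 1) * limitRate c mu n * Real.exp (-(limitRate c mu n * x))

/-- The series `∑_{n ≥ 1}` of the terms above, with the index shifted by one. -/
def limitDensity (c mu x : ℝ) : ℝ := ∑' n : ℕ, densityTerm c mu x (n + 1)

/-- A law on `ℝ` is infinitely divisible if for every `n ≥ 1` it is the law of a sum of `n`
independent random variables with a common law. -/
def IsInfinitelyDivisible (ν : Measure ℝ) : Prop :=
  ∀ n : ℕ, 1 ≤ n → ∃ m : Measure ℝ, IsProbabilityMeasure m ∧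
    Measure.map (fun y : Fin n → ℝ => ∑ i, y i) (Measure.pi fun _ : Fin n => m) = ν

end FluidPolling

end

noncomputable section

/-! ### Laplace transforms on the half line -/

section Laplace

variable {Ω : Type*} {mΩ : MeasurableSpace Ω} {X : Ω → ℝ} {μ : Measure Ω}

/-! Let `F`, `G` be the joint Laplace transforms of the workloads at the start of a cycle and at the
end of the visit to queue 1. Integrating over one exponential visit gives two linear equations
between them (`jointLaplace_afterFirst`, `jointLaplace_afterSecond`), each with an unknown function
of one variable: `g` for `V₂` on `{V₁ = 0}` after visit 1, `f` for `V₁` on `{V₂ = 0}` after visit 2.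
At the arguments `(conj s, s)` the coefficients are `c z` and `c w` with `w = conj z`. On the curve
`|z| = 1`, an ellipse in `s`, the determinant vanishes, `F` and `G` drop out, and `s conj f + w conj
s g = 0` remains.

With `q = ρ / (1 - ρ)` the ellipse is `s = K (1 - w)(1 - q z)`, `z w = 1`. For the rates `σ_n` of
`summandRate` this substitution factorises every `1 + s / σ_n`, and a telescoping product
(`rateProduct_functional_equation`) turns the relation into `conj (f P) = g P` for `P = ∏ (1 + s /
σ_n)`. Then `(g + f) P` and `i (g - f) P` are real on the boundary, hence constant inside. On the
diagonal the two equations then give `E exp (-s (V₁ + V₂)) = 1 / P(s)`, the constant being fixed by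
`s ↓ 0`; the same holds for `G`. So for every `ρ`, not just in the limit, the scaled total workload
is distributed as a series of independent exponentials. An arbitrary epoch changes nothing: by the
exponential form of the visit times its law is the average of the laws at the ends of the two kinds
of visits (`IsCycleStationary.arbitraryEpochLaw_eq`).

The density follows from partial fractions of the finite partial sums. Differences of rates are
products of `q`-numbers, so the weights have a closed form, are bounded by `2n + 3`, and converge.
As the rates are at least `C (n + 1)²` uniformly in `q`, dominated convergence gives first the
mixture series for fixed `q` and then its limit as `q ↑ 1`. Convergence in distribution comes from
coupling all `q` on the same variables, and infinite divisibility from replacing exponentials by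
gamma variables of shape `1 / k`. -/

lemma norm_cexp_mul_le_one {z : ℂ} {x : ℝ} (hz : z.re ≤ 0) (hx : 0 ≤ x) :
    ‖Complex.exp (z * x)‖ ≤ 1 := by
  rw [Complex.norm_exp]
  simpa using mul_nonpos_of_nonpos_of_nonneg hz hx

lemma integrable_exp_mul_of_nonpos [IsFiniteMeasure μ] (hm : AEMeasurable X μ)
    (hX : ∀ᵐ ω ∂μ, 0 ≤ X ω) {t : ℝ} (ht : t ≤ 0) :
    Integrable (fun ω => Real.exp (t * X ω)) μ := by
  refine Integrable.of_bound (C := 1) (by fun_prop) ?_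
  filter_upwards [hX] with ω h
  simpa [abs_of_pos (Real.exp_pos _)] using mul_nonpos_of_nonpos_of_nonneg ht h

lemma Iio_subset_interior_integrableExpSet [IsFiniteMeasure μ] (hm : AEMeasurable X μ)
    (hX : ∀ᵐ ω ∂μ, 0 ≤ X ω) : Iio 0 ⊆ interior (integrableExpSet X μ) :=
  interior_maximal (fun _ ht => integrable_exp_mul_of_nonpos hm hX (le_of_lt ht)) isOpen_Iio

lemma differentiableOn_complexMGF_of_nonneg [IsFiniteMeasure μ] (hm : AEMeasurable X μ)
    (hX : ∀ᵐ ω ∂μ, 0 ≤ X ω) : DifferentiableOn ℂ (complexMGF X μ) {z | z.re < 0} :=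
  differentiableOn_complexMGF.mono fun _ hz => Iio_subset_interior_integrableExpSet hm hX hz

lemma continuousOn_complexMGF_of_nonneg [IsFiniteMeasure μ] (hm : AEMeasurable X μ)
    (hX : ∀ᵐ ω ∂μ, 0 ≤ X ω) : ContinuousOn (complexMGF X μ) {z | z.re ≤ 0} := by
  unfold complexMGF
  refine continuousOn_of_dominated (bound := fun _ => 1) (fun z _ => by fun_prop)
    (fun z hz => ?_) (integrable_const _) (ae_of_all _ fun ω => by fun_prop)
  filter_upwards [hX] with ω h using norm_cexp_mul_le_one hz h

/-- A finite measure on the half line is determined by the values of its Laplace transform on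
any nonempty open interval. -/
theorem ext_of_mgf_eqOn_Ioo {μ ν : Measure ℝ} [IsFiniteMeasure μ] [IsFiniteMeasure ν]
    (hμ : ∀ᵐ x ∂μ, 0 ≤ x) (hν : ∀ᵐ x ∂ν, 0 ≤ x) {a b : ℝ} (hab : a < b) (hb : b ≤ 0)
    (h : ∀ t ∈ Ioo a b, mgf id μ t = mgf id ν t) : μ = ν := by
  have hopen : IsOpen {z : ℂ | z.re < 0} := isOpen_lt Complex.continuous_re continuous_const
  -- Identity theorem in the open left half plane: agreement at real points accumulating at `t`
  -- suffices.
  have key : EqOn (complexMGF id μ) (complexMGF id ν) {z | z.re < 0} := by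
    obtain ⟨t, ht⟩ := exists_between hab
    refine AnalyticOnNhd.eqOn_of_preconnected_of_frequently_eq
      ((differentiableOn_complexMGF_of_nonneg aemeasurable_id hμ).analyticOnNhd hopen)
      ((differentiableOn_complexMGF_of_nonneg aemeasurable_id hν).analyticOnNhd hopen)
      (convex_halfSpace_re_lt 0).isPreconnected (z₀ := (t : ℂ))
      (by simpa using ht.2.trans_le hb) ?_
    have h1 : ∃ᶠ x : ℝ in 𝓝[≠] t, complexMGF id μ x = complexMGF id ν x := by
      refine Eventually.frequently ?_
      filter_upwards [nhdsWithin_le_nhds (Ioo_mem_nhds ht.1 ht.2)] with x hx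
      rw [complexMGF_ofReal, complexMGF_ofReal, h x hx]
    rw [frequently_iff_seq_forall] at h1 ⊢
    obtain ⟨xs, hx, he⟩ := h1
    refine ⟨fun n => xs n, ?_, fun n => by simpa using he n⟩
    rw [tendsto_nhdsWithin_iff] at hx ⊢
    exact ⟨(Complex.continuous_ofReal.tendsto _).comp hx.1, by simpa using hx.2⟩
  -- Continuity carries the identity to the imaginary axis, where the transform is the
  -- characteristic function.
  have key2 : EqOn (complexMGF id μ) (complexMGF id ν) {z | z.re ≤ 0} := by
    refine key.of_subset_closure (continuousOn_complexMGF_of_nonneg aemeasurable_id hμ)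
      (continuousOn_complexMGF_of_nonneg aemeasurable_id hν) (fun z (hz : z.re < 0) => hz.le) ?_
    intro z hz
    refine mem_closure_of_tendsto (f := fun n : ℕ => z - ((1 / ((n : ℝ) + 1) : ℝ) : ℂ))
      (b := atTop) ?_ (Eventually.of_forall fun n => ?_)
    · have := (Complex.continuous_ofReal.tendsto _).comp
        (tendsto_one_div_add_atTop_nhds_zero_nat (𝕜 := ℝ))
      simpa using (tendsto_const_nhds (x := z)).sub this
    · have : (0 : ℝ) < 1 / ((n : ℝ) + 1) := by positivity
      have hz' : z.re ≤ 0 := hz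
      simp only [mem_ofPred_eq, Complex.sub_re, Complex.ofReal_re]
      linarith
  refine Measure.ext_of_charFun ?_
  funext t
  rw [← complexMGF_id_mul_I, ← complexMGF_id_mul_I]
  exact key2 (by simp)

end Laplace

/-! ### Gamma and exponential laws -/

section Gamma

lemma ae_nonneg_gammaMeasure (a r : ℝ) : ∀ᵐ x ∂gammaMeasure a r, 0 ≤ x := by
  rw [gammaMeasure, ae_iff]
  simp only [not_le]
  change (volume.withDensity (gammaPDF a r)) (Iio 0) = 0
  rw [withDensity_apply _ measurableSet_Iio]
  exact lintegral_gammaPDF_of_nonpos le_rfl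

lemma ae_nonneg_expMeasure (r : ℝ) : ∀ᵐ x ∂expMeasure r, 0 ≤ x := ae_nonneg_gammaMeasure 1 r

lemma integral_gammaMeasure {E : Type*} [NormedAddCommGroup E] [NormedSpace ℝ E]
    {a r : ℝ} (ha : 0 < a) (hr : 0 < r) (f : ℝ → E) :
    ∫ x, f x ∂gammaMeasure a r =
      ∫ x in Ioi 0, (r ^ a / Real.Gamma a * x ^ (a - 1) * Real.exp (-(r * x))) • f x := by
  rw [gammaMeasure, integral_withDensity_eq_integral_toReal_smul (by exact (measurable_gammaPDFReal a r).ennreal_ofReal)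
    (ae_of_all _ fun x => by simp [gammaPDF])]
  rw [← integral_indicator measurableSet_Ioi]
  refine integral_congr_ae ?_
  have : ∀ᵐ x : ℝ, x ≠ 0 := by simp [ae_iff]
  filter_upwards [this] with x hx
  rcases lt_or_gt_of_ne hx with h | h
  · simp [gammaPDF_of_neg h, h.le]
  · rw [indicator_of_mem (by exact h), gammaPDF_of_nonneg h.le, ENNReal.toReal_ofReal]
    have := Real.Gamma_pos_of_pos ha
    positivity

lemma integral_expMeasure {E : Type*} [NormedAddCommGroup E] [NormedSpace ℝ E]
    {r : ℝ} (hr : 0 < r) (f : ℝ → E) :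
    ∫ x, f x ∂expMeasure r = ∫ x in Ioi 0, (r * Real.exp (-(r * x))) • f x := by
  rw [expMeasure, integral_gammaMeasure one_pos hr]
  simp

lemma mgf_gammaMeasure {a r t : ℝ} (ha : 0 < a) (hr : 0 < r) (ht : t ≤ 0) :
    mgf id (gammaMeasure a r) t = (r / (r - t)) ^ a := by
  have hrt : 0 < r - t := by linarith
  rw [mgf, integral_gammaMeasure ha hr]
  have h := Real.integral_rpow_mul_exp_neg_mul_Ioi ha hrt
  have hG := Real.Gamma_pos_of_pos ha
  calc _ = ∫ x in Ioi (0 : ℝ), r ^ a / Real.Gamma a * (x ^ (a - 1) * Real.exp (-((r - t) * x))) := by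
        congr 1; funext x
        rw [smul_eq_mul, id, show -((r - t) * x) = -(r * x) + t * x by ring, Real.exp_add]; ring
    _ = _ := by
        rw [integral_const_mul, h, Real.div_rpow hr.le hrt.le, Real.div_rpow one_pos.le hrt.le,
          Real.one_rpow]
        field_simp

lemma mgf_expMeasure {r t : ℝ} (hr : 0 < r) (ht : t ≤ 0) :
    mgf id (expMeasure r) t = r / (r - t) := by
  rw [expMeasure, mgf_gammaMeasure one_pos hr ht, Real.rpow_one]

lemma expMeasure_Ioi {r x : ℝ} (hr : 0 < r) (hx : 0 ≤ x) :
    (expMeasure r).real (Ioi x) = Real.exp (-(r * x)) := by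
  have := isProbabilityMeasure_expMeasure hr
  have h := cdf_expMeasure_eq hr x
  rw [cdf_eq_real, if_pos hx] at h
  rw [← compl_Iic, probReal_compl_eq_one_sub measurableSet_Iic, h]
  ring

lemma lintegral_id_gammaMeasure_lt_top {a : ℝ} (ha : 0 < a) :
    ∫⁻ x, ENNReal.ofReal x ∂gammaMeasure a 1 < ⊤ := by
  rw [gammaMeasure, lintegral_withDensity_eq_lintegral_mul _ (by exact (measurable_gammaPDFReal a 1).ennreal_ofReal)
    (by fun_prop)]
  have h : IntegrableOn (fun x : ℝ => Real.exp (-x) * x ^ (a + 1 - 1)) (Ioi 0) :=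
    Real.GammaIntegral_convergent (by linarith)
  have h2 := (h.const_mul (1 / Real.Gamma a)).lintegral_lt_top
  refine lt_of_le_of_lt ?_ h2
  rw [← lintegral_indicator measurableSet_Ioi]
  refine lintegral_mono_ae ?_
  have : ∀ᵐ x : ℝ, x ≠ 0 := by simp [ae_iff]
  filter_upwards [this] with x hx
  rcases lt_or_gt_of_ne hx with h | h
  · simp [gammaPDF_of_neg h]
  · rw [indicator_of_mem (by exact h), Pi.mul_apply, gammaPDF_of_nonneg h.le, ← ENNReal.ofReal_mul]
    · refine ENNReal.ofReal_le_ofReal (le_of_eq ?_)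
      rw [add_sub_cancel_right, Real.rpow_sub_one hx]
      have := Real.Gamma_pos_of_pos ha
      simp; field_simp
    · have := Real.Gamma_pos_of_pos ha
      positivity

end Gamma

end

noncomputable section

/-! ### Series of independent scaled gamma variables -/

section GammaSeries

variable {Ω : Type*} {mΩ : MeasurableSpace Ω} {P : Measure Ω} {E : ℕ → Ω → ℝ} {a : ℝ} {r : ℕ → ℝ}

lemma ae_forall_nonneg_of_hasLaw_gamma (hE : ∀ n, HasLaw (E n) (gammaMeasure a 1) P) :
    ∀ᵐ ω ∂P, ∀ n, 0 ≤ E n ω := by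
  rw [ae_all_iff]
  intro n
  exact ((hE n).ae_iff (p := fun x => 0 ≤ x) (by measurability)).2 (ae_nonneg_gammaMeasure a 1)

/-- By Tonelli the expected sum is the finite mean of one gamma variable times `∑ 1 / r_n`, and a
nonnegative sum of finite expectation is almost surely finite. -/
lemma ae_summable_div_of_hasLaw_gamma (ha : 0 < a)
    (hE : ∀ n, HasLaw (E n) (gammaMeasure a 1) P) (hr : ∀ n, 0 < r n)
    (hs : Summable fun n => (r n)⁻¹) : ∀ᵐ ω ∂P, Summable fun n => E n ω / r n := by
  have hm : ∀ n, AEMeasurable (fun ω => ENNReal.ofReal (E n ω / r n)) P := fun n =>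
    ((hE n).aemeasurable.div_const _).ennreal_ofReal
  have h1 : ∫⁻ ω, ∑' n, ENNReal.ofReal (E n ω / r n) ∂P ≠ ⊤ := by
    rw [lintegral_tsum hm]
    have h2 : ∀ n, ∫⁻ ω, ENNReal.ofReal (E n ω / r n) ∂P =
        (∫⁻ x, ENNReal.ofReal x ∂gammaMeasure a 1) * ENNReal.ofReal (r n)⁻¹ := by
      intro n
      rw [← lintegral_mul_const _ (by fun_prop), ← (hE n).map_eq,
        lintegral_map' (by fun_prop) (hE n).aemeasurable]
      refine lintegral_congr fun ω => ?_
      rw [← ENNReal.ofReal_mul' (inv_nonneg.2 (hr n).le), div_eq_mul_inv]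
    simp_rw [h2]
    rw [ENNReal.tsum_mul_left]
    refine ENNReal.mul_ne_top (lintegral_id_gammaMeasure_lt_top ha).ne ?_
    rw [← ENNReal.ofReal_tsum_of_nonneg (fun n => inv_nonneg.2 (hr n).le) hs]
    exact ENNReal.ofReal_ne_top
  filter_upwards [ae_lt_top' (AEMeasurable.tsum hm) h1,
    ae_forall_nonneg_of_hasLaw_gamma hE] with ω h2 h3
  refine (ENNReal.summable_toReal h2.ne).congr fun n => ?_
  rw [ENNReal.toReal_ofReal (div_nonneg (h3 n) (hr n).le)]

lemma aemeasurable_tsum_div (ha : 0 < a)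
    (hE : ∀ n, HasLaw (E n) (gammaMeasure a 1) P) (hr : ∀ n, 0 < r n)
    (hs : Summable fun n => (r n)⁻¹) : AEMeasurable (fun ω => ∑' n, E n ω / r n) P := by
  refine aemeasurable_of_tendsto_metrizable_ae atTop
    (f := fun M ω => ∑ n ∈ Finset.range M, E n ω / r n) (fun M => ?_) ?_
  · exact Finset.aemeasurable_fun_sum _ fun n _ => (hE n).aemeasurable.div_const _
  · filter_upwards [ae_summable_div_of_hasLaw_gamma ha hE hr hs] with ω h
    exact h.hasSum.tendsto_sum_nat

lemma mgf_sum_div_of_hasLaw_gamma (ha : 0 < a) (hind : iIndepFun E P)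
    (hE : ∀ n, HasLaw (E n) (gammaMeasure a 1) P) (hr : ∀ n, 0 < r n) {t : ℝ} (ht : t ≤ 0)
    (s : Finset ℕ) :
    mgf (fun ω => ∑ n ∈ s, E n ω / r n) P t = ∏ n ∈ s, (r n / (r n - t)) ^ a := by
  have h := (hind.comp (fun n x => x / r n) (fun n => by fun_prop)).mgf_sum₀ (t := t)
    (fun n => ((hE n).aemeasurable.div_const _)) s
  have h0 : (fun ω => ∑ n ∈ s, E n ω / r n) = ∑ n ∈ s, (fun x => x / r n) ∘ E n := by
    funext ω; simp
  rw [h0, h]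
  refine Finset.prod_congr rfl fun n _ => ?_
  have h1 : mgf id (gammaMeasure a 1) (t / r n) = (1 / (1 - t / r n)) ^ a :=
    mgf_gammaMeasure ha one_pos (div_nonpos_of_nonpos_of_nonneg ht (hr n).le)
  rw [← (hE n).map_eq, mgf_id_map (hE n).aemeasurable] at h1
  have h2 : r n / (r n - t) = 1 / (1 - t / r n) := by
    rw [one_sub_div (hr n).ne', one_div_div]
  rw [h2, ← h1, mgf, mgf]
  congr 1; funext ω
  simp only [Function.comp]
  congr 1; ring

theorem tendsto_prod_mgf_tsum_div (ha : 0 < a) (hind : iIndepFun E P)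
    (hE : ∀ n, HasLaw (E n) (gammaMeasure a 1) P) (hr : ∀ n, 0 < r n)
    (hs : Summable fun n => (r n)⁻¹) {t : ℝ} (ht : t ≤ 0) :
    Tendsto (fun M => ∏ n ∈ Finset.range M, (r n / (r n - t)) ^ a) atTop
      (𝓝 (mgf (fun ω => ∑' n, E n ω / r n) P t)) := by
  have := hind.isProbabilityMeasure
  simp_rw [← mgf_sum_div_of_hasLaw_gamma ha hind hE hr ht]
  unfold mgf
  refine tendsto_integral_of_dominated_convergence (fun _ => 1) (fun M => ?_)
    (integrable_const _) (fun M => ?_) ?_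
  · have : AEMeasurable (fun ω => ∑ n ∈ Finset.range M, E n ω / r n) P :=
      Finset.aemeasurable_fun_sum _ fun n _ => (hE n).aemeasurable.div_const _
    exact (Real.measurable_exp.comp_aemeasurable (this.const_mul t)).aestronglyMeasurable
  · filter_upwards [ae_forall_nonneg_of_hasLaw_gamma hE] with ω h
    simp only [Real.norm_eq_abs, Real.abs_exp, Real.exp_le_one_iff]
    exact mul_nonpos_of_nonpos_of_nonneg ht
      (Finset.sum_nonneg fun n _ => div_nonneg (h n) (hr n).le)
  · filter_upwards [ae_summable_div_of_hasLaw_gamma ha hE hr hs] with ω h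
    exact (Real.continuous_exp.tendsto _).comp (h.hasSum.tendsto_sum_nat.const_mul t)

/-- The law of `∑ γ_n / r_n` for independent gamma variables `γ_n` of shape `a` and rate `1`. -/
def gammaSeriesLaw (a : ℝ) (r : ℕ → ℝ) : Measure ℝ :=
  Measure.map (fun ω : ℕ → ℝ => ∑' n, ω n / r n) (Measure.infinitePi fun _ => gammaMeasure a 1)

lemma hasLaw_eval_infinitePi (ha : 0 < a) (n : ℕ) :
    HasLaw (fun ω : ℕ → ℝ => ω n) (gammaMeasure a 1)
      (Measure.infinitePi fun _ => gammaMeasure a 1) := by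
  have := isProbabilityMeasure_gammaMeasure ha one_pos
  exact (measurePreserving_eval_infinitePi (fun _ : ℕ => gammaMeasure a 1) n).hasLaw

lemma iIndepFun_eval_infinitePi (ha : 0 < a) :
    iIndepFun (fun (n : ℕ) (ω : ℕ → ℝ) => ω n)
      (Measure.infinitePi fun _ => gammaMeasure a 1) := by
  have := isProbabilityMeasure_gammaMeasure ha one_pos
  exact iIndepFun_infinitePi (X := fun _ x => x) (fun _ => measurable_id)

lemma isProbabilityMeasure_gammaSeriesLaw (ha : 0 < a) (hr : ∀ n, 0 < r n)
    (hs : Summable fun n => (r n)⁻¹) : IsProbabilityMeasure (gammaSeriesLaw a r) := by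
  have := isProbabilityMeasure_gammaMeasure ha one_pos
  exact Measure.isProbabilityMeasure_map
    (aemeasurable_tsum_div ha (hasLaw_eval_infinitePi ha) hr hs)

lemma ae_nonneg_tsum_div (hE : ∀ n, HasLaw (E n) (gammaMeasure a 1) P) (hr : ∀ n, 0 < r n) :
    ∀ᵐ ω ∂P, 0 ≤ ∑' n, E n ω / r n := by
  filter_upwards [ae_forall_nonneg_of_hasLaw_gamma hE] with ω h
  exact tsum_nonneg fun n => div_nonneg (h n) (hr n).le

lemma ae_nonneg_gammaSeriesLaw (ha : 0 < a) (hr : ∀ n, 0 < r n)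
    (hs : Summable fun n => (r n)⁻¹) : ∀ᵐ x ∂gammaSeriesLaw a r, 0 ≤ x := by
  rw [gammaSeriesLaw, ae_map_iff (aemeasurable_tsum_div ha (hasLaw_eval_infinitePi ha) hr hs)
    measurableSet_Ici]
  exact ae_nonneg_tsum_div (hasLaw_eval_infinitePi ha) hr

/-- The first summand alone is almost surely positive, the gamma law having no atom at `0`. -/
lemma ae_pos_gammaSeriesLaw (ha : 0 < a) (hr : ∀ n, 0 < r n)
    (hs : Summable fun n => (r n)⁻¹) : ∀ᵐ x ∂gammaSeriesLaw a r, 0 < x := by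
  rw [gammaSeriesLaw, ae_map_iff (aemeasurable_tsum_div ha (hasLaw_eval_infinitePi ha) hr hs)
    measurableSet_Ioi]
  have h0 : ∀ᵐ x ∂gammaMeasure a 1, x ≠ 0 :=
    (withDensity_absolutelyContinuous _ _).ae_le (show ∀ᵐ x : ℝ, x ≠ 0 by simp [ae_iff])
  filter_upwards [ae_forall_nonneg_of_hasLaw_gamma (hasLaw_eval_infinitePi ha),
    ae_summable_div_of_hasLaw_gamma ha (hasLaw_eval_infinitePi ha) hr hs,
    ((hasLaw_eval_infinitePi ha 0).ae_iff (p := fun x => x ≠ 0) (by measurability)).2 h0]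
    with ω h1 h2 h3
  exact h2.tsum_pos (fun n => div_nonneg (h1 n) (hr n).le) 0
    (div_pos (lt_of_le_of_ne (h1 0) (Ne.symm h3)) (hr 0))

theorem tendsto_prod_mgf_gammaSeriesLaw (ha : 0 < a) (hr : ∀ n, 0 < r n)
    (hs : Summable fun n => (r n)⁻¹) {t : ℝ} (ht : t ≤ 0) :
    Tendsto (fun M => ∏ n ∈ Finset.range M, (r n / (r n - t)) ^ a) atTop
      (𝓝 (mgf id (gammaSeriesLaw a r) t)) := by
  rw [gammaSeriesLaw, mgf_id_map (aemeasurable_tsum_div ha (hasLaw_eval_infinitePi ha) hr hs)]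
  exact tendsto_prod_mgf_tsum_div ha (iIndepFun_eval_infinitePi ha) (hasLaw_eval_infinitePi ha)
    hr hs ht

/-- A law on the half line is that of the series as soon as its Laplace transform is the
corresponding infinite product on some interval. -/
theorem eq_gammaSeriesLaw_of_tendsto (ha : 0 < a) (hr : ∀ n, 0 < r n)
    (hs : Summable fun n => (r n)⁻¹) {μ : Measure ℝ} [IsFiniteMeasure μ]
    (hμ : ∀ᵐ x ∂μ, 0 ≤ x) {b : ℝ} (hb : b < 0)
    (h : ∀ t ∈ Ioo b 0, Tendsto (fun M => ∏ n ∈ Finset.range M, (r n / (r n - t)) ^ a) atTop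
      (𝓝 (mgf id μ t))) : μ = gammaSeriesLaw a r := by
  have := isProbabilityMeasure_gammaSeriesLaw ha hr hs
  refine ext_of_mgf_eqOn_Ioo hμ (ae_nonneg_gammaSeriesLaw ha hr hs) hb le_rfl fun t ht => ?_
  exact tendsto_nhds_unique (h t ht) (tendsto_prod_mgf_gammaSeriesLaw ha hr hs ht.2.le)

theorem hasLaw_tsum_div_gammaSeriesLaw (ha : 0 < a) (hind : iIndepFun E P)
    (hE : ∀ n, HasLaw (E n) (gammaMeasure a 1) P) (hr : ∀ n, 0 < r n)
    (hs : Summable fun n => (r n)⁻¹) :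
    HasLaw (fun ω => ∑' n, E n ω / r n) (gammaSeriesLaw a r) P := by
  have := hind.isProbabilityMeasure
  have hm := aemeasurable_tsum_div ha hE hr hs
  have := Measure.isProbabilityMeasure_map hm
  refine ⟨hm, eq_gammaSeriesLaw_of_tendsto ha hr hs ?_ neg_one_lt_zero fun t ht => ?_⟩
  · rw [ae_map_iff hm measurableSet_Ici]
    exact ae_nonneg_tsum_div hE hr
  · rw [mgf_id_map hm]
    exact tendsto_prod_mgf_tsum_div ha hind hE hr hs ht.2.le

/-- Factor by factor, the transform for shape `1 / k` is the `k`-th root of that for shape `1`, so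
the `k` summands may be taken as independent series with gamma variables of shape `1 / k`. This is
the reason for allowing a general shape. -/
lemma gammaSeriesLaw_infinitelyDivisible (hr : ∀ n, 0 < r n) (hs : Summable fun n => (r n)⁻¹) :
    FluidPolling.IsInfinitelyDivisible (gammaSeriesLaw 1 r) := by
  intro k hk
  have hk0 : (0 : ℝ) < (k : ℝ)⁻¹ := by positivity
  have hp := isProbabilityMeasure_gammaSeriesLaw hk0 hr hs
  have hm : Measurable fun y : Fin k → ℝ => ∑ i, y i := by fun_prop
  refine ⟨gammaSeriesLaw (k : ℝ)⁻¹ r, hp, ?_⟩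
  have := Measure.isProbabilityMeasure_map
    (μ := Measure.pi fun _ : Fin k => gammaSeriesLaw (k : ℝ)⁻¹ r) hm.aemeasurable
  refine eq_gammaSeriesLaw_of_tendsto one_pos hr hs ?_ neg_one_lt_zero fun t ht => ?_
  · rw [ae_map_iff hm.aemeasurable measurableSet_Ici]
    have h : ∀ i : Fin k, ∀ᵐ y ∂Measure.pi fun _ : Fin k => gammaSeriesLaw (k : ℝ)⁻¹ r, 0 ≤ y i :=
      fun i => Measure.tendsto_eval_ae_ae.eventually (ae_nonneg_gammaSeriesLaw hk0 hr hs)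
    filter_upwards [ae_all_iff.2 h] with y hy using Finset.sum_nonneg fun i _ => hy i
  · have h1 : mgf id (Measure.map (fun y : Fin k → ℝ => ∑ i, y i)
        (Measure.pi fun _ => gammaSeriesLaw (k : ℝ)⁻¹ r)) t =
        (mgf id (gammaSeriesLaw (k : ℝ)⁻¹ r) t) ^ k := by
      rw [mgf_id_map hm.aemeasurable, mgf]
      simp_rw [Finset.mul_sum, Real.exp_sum]
      rw [integral_fintype_prod_eq_pow (fun x => Real.exp (t * x))]
      simp [mgf]
    rw [h1]
    refine ((tendsto_prod_mgf_gammaSeriesLaw hk0 hr hs ht.2.le).pow k).congr fun M => ?_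
    rw [← Finset.prod_pow]
    refine Finset.prod_congr rfl fun n _ => ?_
    rw [Real.rpow_one, Real.rpow_inv_natCast_pow (div_nonneg (hr n).le _) (by omega)]
    linarith [hr n, ht.2]

/-- Coupling: the same gamma variables serve every `i`, and the series with the smallest rates `b`
dominates the others, so the series converge almost surely and not only in law. -/
theorem tendsto_integral_gammaSeriesLaw {ι : Type*} {l : Filter ι} [l.IsCountablyGenerated]
    (ha : 0 < a) {R : ι → ℕ → ℝ} {b : ℕ → ℝ} (hb : ∀ n, 0 < b n)
    (hs : Summable fun n => (b n)⁻¹) (hR : ∀ᶠ i in l, ∀ n, b n ≤ R i n) (hr : ∀ n, b n ≤ r n)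
    (hlim : ∀ n, Tendsto (fun i => R i n) l (𝓝 (r n))) (g : BoundedContinuousFunction ℝ ℝ) :
    Tendsto (fun i => ∫ x, g x ∂gammaSeriesLaw a (R i)) l
      (𝓝 (∫ x, g x ∂gammaSeriesLaw a r)) := by
  have := isProbabilityMeasure_gammaMeasure ha one_pos
  set P : Measure (ℕ → ℝ) := Measure.infinitePi fun _ => gammaMeasure a 1
  have hmeas : ∀ ρ : ℕ → ℝ, (∀ n, b n ≤ ρ n) →
      AEMeasurable (fun ω : ℕ → ℝ => ∑' n, ω n / ρ n) P := fun ρ hρ =>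
    aemeasurable_tsum_div ha (hasLaw_eval_infinitePi ha) (fun n => (hb n).trans_le (hρ n))
      (hs.of_nonneg_of_le (fun n => inv_nonneg.2 ((hb n).le.trans (hρ n)))
        fun n => inv_anti₀ (hb n) (hρ n))
  have hint : ∀ ρ : ℕ → ℝ, (∀ n, b n ≤ ρ n) →
      ∫ x, g x ∂gammaSeriesLaw a ρ = ∫ ω, g (∑' n, ω n / ρ n) ∂P := fun ρ hρ =>
    integral_map (hmeas ρ hρ) g.continuous.aestronglyMeasurable
  rw [hint r hr]
  refine Tendsto.congr' (f₁ := fun i => ∫ ω, g (∑' n, ω n / R i n) ∂P) ?_ ?_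
  · filter_upwards [hR] with i hi using (hint _ hi).symm
  refine tendsto_integral_filter_of_dominated_convergence (fun _ => ‖g‖) ?_ ?_
    (integrable_const _) ?_
  · filter_upwards [hR] with i hi
    exact g.continuous.aestronglyMeasurable.comp_aemeasurable (hmeas _ hi)
  · exact Eventually.of_forall fun i => ae_of_all _ fun ω => g.norm_coe_le_norm _
  · filter_upwards [ae_forall_nonneg_of_hasLaw_gamma (hasLaw_eval_infinitePi ha),
      ae_summable_div_of_hasLaw_gamma ha (hasLaw_eval_infinitePi ha) hb hs] with ω h0 h1
    refine (g.continuous.tendsto _).comp (tendsto_tsum_of_dominated_convergence h1 (fun n => ?_) ?_)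
    · exact tendsto_const_nhds.div (hlim n) ((hb n).trans_le (hr n)).ne'
    · filter_upwards [hR] with i hi n
      rw [Real.norm_of_nonneg (div_nonneg (h0 n) ((hb n).le.trans (hi n)))]
      exact div_le_div_of_nonneg_left (h0 n) (hb n) (hi n)

end GammaSeries

end

noncomputable section

/-! ### Partial fractions and tails of finite sums of exponentials -/

section Hypoexponential

variable {r : ℕ → ℝ}

/-- The weights of the hypoexponential law with rates `r 0, …, r (M - 1)`. -/
def hypoexpWeight (r : ℕ → ℝ) (M n : ℕ) : ℝ :=
  ∏ m ∈ (Finset.range M).erase n, r m / (r m - r n)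

/-- Partial fractions. -/
lemma prod_div_add_eq_sum_hypoexpWeight (hr : ∀ n, 0 < r n) (hinj : Function.Injective r)
    {M : ℕ} (hM : M ≠ 0) {s : ℝ} (hs : 0 ≤ s) :
    ∏ m ∈ Finset.range M, r m / (r m + s) =
      ∑ n ∈ Finset.range M, hypoexpWeight r M n * (r n / (r n + s)) := by
  -- The Lagrange basis polynomials for the nodes `r 0, …, r (M - 1)` sum to `1`; evaluation at `-s`
  -- and multiplication by the product give the expansion.
  have h := congrArg (Polynomial.eval (-s)) (Lagrange.sum_basis (s := Finset.range M) (v := r)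
    hinj.injOn (by simpa using hM))
  rw [Polynomial.eval_finsetSum, Polynomial.eval_one] at h
  rw [← mul_one (∏ m ∈ Finset.range M, r m / (r m + s)), ← h, Finset.mul_sum]
  refine Finset.sum_congr rfl fun n hn => ?_
  rw [Lagrange.basis, Polynomial.eval_prod, ← Finset.mul_prod_erase _ _ hn, hypoexpWeight,
    mul_comm (∏ m ∈ (Finset.range M).erase n, r m / (r m - r n)), mul_assoc,
    ← Finset.prod_mul_distrib]
  congr 1
  refine Finset.prod_congr rfl fun m hm => ?_
  have h1 : r m - r n ≠ 0 := sub_ne_zero.2 fun h => (Finset.mem_erase.1 hm).1 (hinj h)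
  have h2 : r n - r m ≠ 0 := fun h => h1 (by linarith)
  have h3 : r m + s ≠ 0 := by linarith [hr m]
  simp only [Lagrange.basisDivisor, Polynomial.eval_mul, Polynomial.eval_C, Polynomial.eval_sub,
    Polynomial.eval_X]
  field_simp
  ring

lemma real_Ioi_eq_sum_hypoexpWeight {μ : Measure ℝ} [IsProbabilityMeasure μ]
    (hμ : ∀ᵐ x ∂μ, 0 ≤ x) (hr : ∀ n, 0 < r n) (hinj : Function.Injective r) {M : ℕ} (hM : M ≠ 0)
    (h : ∀ t ≤ 0, mgf id μ t = ∏ m ∈ Finset.range M, r m / (r m - t)) {x : ℝ} (hx : 0 ≤ x) :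
    μ.real (Ioi x) = ∑ n ∈ Finset.range M, hypoexpWeight r M n * Real.exp (-(r n * x)) := by
  have hp : ∀ n, IsProbabilityMeasure (expMeasure (r n)) := fun n =>
    isProbabilityMeasure_expMeasure (hr n)
  -- The weights have both signs. Moving the negative ones to the other side leaves an identity
  -- between finite measures, to which uniqueness of the Laplace transform applies.
  set w := hypoexpWeight r M
  set pos : Measure ℝ := ∑ n ∈ Finset.range M, ENNReal.ofReal (w n) • expMeasure (r n)
  set neg : Measure ℝ := ∑ n ∈ Finset.range M, ENNReal.ofReal (-w n) • expMeasure (r n)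
  have hfin : ∀ c : ℕ → ℝ, IsFiniteMeasure
      (∑ n ∈ Finset.range M, ENNReal.ofReal (c n) • expMeasure (r n)) := fun c => by
    constructor
    simp [ENNReal.sum_lt_top]
  have := hfin w
  have := hfin (fun n => -w n)
  have hnn : ∀ c : ℕ → ℝ, ∀ᵐ x ∂(∑ n ∈ Finset.range M, ENNReal.ofReal (c n) • expMeasure (r n)),
      0 ≤ x := fun c => by
    rw [ae_iff, Measure.finsetSum_apply, Finset.sum_eq_zero]
    intro n _
    rw [Measure.smul_apply, (ae_iff.1 (ae_nonneg_expMeasure (r n))), smul_zero]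
  have hmgf : ∀ c : ℕ → ℝ, ∀ t ≤ 0,
      mgf id (∑ n ∈ Finset.range M, ENNReal.ofReal (c n) • expMeasure (r n)) t =
        ∑ n ∈ Finset.range M, max (c n) 0 * (r n / (r n - t)) := fun c t ht => by
    rw [mgf, integral_finsetSum_measure]
    · refine Finset.sum_congr rfl fun n _ => ?_
      have := mgf_expMeasure (hr n) ht
      rw [mgf] at this
      rw [integral_smul_measure, this, ENNReal.toReal_ofReal', smul_eq_mul]
    · intro n _
      exact (integrable_exp_mul_of_nonpos aemeasurable_id (ae_nonneg_expMeasure (r n))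
        ht).smul_measure ENNReal.ofReal_ne_top
  have key : μ + neg = pos := by
    refine ext_of_mgf_eqOn_Ioo ?_ (hnn w) neg_one_lt_zero le_rfl fun t ht => ?_
    · rw [ae_add_measure_iff]
      exact ⟨hμ, hnn _⟩
    · have h1 := prod_div_add_eq_sum_hypoexpWeight hr hinj hM (s := -t) (by linarith [ht.2])
      simp only [← sub_eq_add_neg] at h1
      rw [mgf_add_measure (integrable_exp_mul_of_nonpos aemeasurable_id hμ ht.2.le)
        (integrable_exp_mul_of_nonpos aemeasurable_id (hnn _) ht.2.le), h t ht.2.le, hmgf _ t ht.2.le,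
        hmgf _ t ht.2.le, h1, ← Finset.sum_add_distrib]
      refine Finset.sum_congr rfl fun n _ => ?_
      rw [← add_mul]
      congr 1
      change w n + _ = _
      rcases le_total (w n) 0 with h0 | h0
      · rw [max_eq_left (by linarith), max_eq_right h0]; ring
      · rw [max_eq_right (by linarith), max_eq_left h0]; ring
  have htail : ∀ c : ℕ → ℝ,
      (∑ n ∈ Finset.range M, ENNReal.ofReal (c n) • expMeasure (r n)).real (Ioi x) =
        ∑ n ∈ Finset.range M, max (c n) 0 * Real.exp (-(r n * x)) := fun c => by
    rw [measureReal_def, Measure.finsetSum_apply, ENNReal.toReal_sum]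
    · refine Finset.sum_congr rfl fun n _ => ?_
      rw [← expMeasure_Ioi (hr n) hx, Measure.smul_apply, smul_eq_mul, ENNReal.toReal_mul,
        ENNReal.toReal_ofReal', measureReal_def]
    · intro n _
      exact ENNReal.mul_ne_top ENNReal.ofReal_ne_top (measure_ne_top _ _)
  have h2 : μ.real (Ioi x) + neg.real (Ioi x) = pos.real (Ioi x) := by
    rw [← key, measureReal_add_apply]
  rw [htail w, htail fun n => -w n] at h2
  rw [eq_sub_of_add_eq h2, ← Finset.sum_sub_distrib]
  refine Finset.sum_congr rfl fun n _ => ?_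
  rw [← sub_mul]
  congr 1
  rcases le_total (w n) 0 with h0 | h0
  · rw [max_eq_left (a := -w n) (by linarith), max_eq_right h0]; ring
  · rw [max_eq_right (a := -w n) (by linarith), max_eq_left h0]; ring

/-- The partial sums of the exponentials increase to the series, so the events that they exceed `x`
increase to the event that the series does. The strict inequality spares any argument about atoms at
`x`. -/
theorem tendsto_sum_hypoexpWeight (hr : ∀ n, 0 < r n) (hinj : Function.Injective r)
    (hs : Summable fun n => (r n)⁻¹) {x : ℝ} (hx : 0 ≤ x) :
    Tendsto (fun M => ∑ n ∈ Finset.range M, hypoexpWeight r M n * Real.exp (-(r n * x))) atTop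
      (𝓝 ((gammaSeriesLaw 1 r).real (Ioi x))) := by
  have := isProbabilityMeasure_gammaMeasure one_pos one_pos
  have hE := hasLaw_eval_infinitePi one_pos
  set P : Measure (ℕ → ℝ) := Measure.infinitePi fun _ => gammaMeasure 1 1
  have hS : ∀ M, Measurable fun ω : ℕ → ℝ => ∑ n ∈ Finset.range M, ω n / r n := fun M => by fun_prop
  have h1 : ∀ M, M ≠ 0 → ∑ n ∈ Finset.range M, hypoexpWeight r M n * Real.exp (-(r n * x)) =
      P.real {ω | x < ∑ n ∈ Finset.range M, ω n / r n} := fun M hM => by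
    have := Measure.isProbabilityMeasure_map (μ := P) (hS M).aemeasurable
    rw [← real_Ioi_eq_sum_hypoexpWeight
      (μ := P.map fun ω : ℕ → ℝ => ∑ n ∈ Finset.range M, ω n / r n) ?_ hr hinj hM ?_ hx,
      map_measureReal_apply (hS M) measurableSet_Ioi]
    · rfl
    · rw [ae_map_iff (hS M).aemeasurable measurableSet_Ici]
      filter_upwards [ae_forall_nonneg_of_hasLaw_gamma hE] with ω h
      exact Finset.sum_nonneg fun n _ => div_nonneg (h n) (hr n).le
    · intro t ht
      rw [mgf_id_map (hS M).aemeasurable,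
        mgf_sum_div_of_hasLaw_gamma one_pos (iIndepFun_eval_infinitePi one_pos) hE hr ht]
      simp
  have hm := aemeasurable_tsum_div one_pos hE hr hs
  have h2 : (gammaSeriesLaw 1 r).real (Ioi x) = P.real {ω | x < ∑' n, ω n / r n} := by
    rw [measureReal_def, gammaSeriesLaw, Measure.map_apply_of_aemeasurable hm measurableSet_Ioi]
    rfl
  rw [h2]
  have hgood : ∀ᵐ ω ∂P, (∀ n, 0 ≤ ω n) ∧ Summable fun n => ω n / r n :=
    (ae_forall_nonneg_of_hasLaw_gamma hE).and (ae_summable_div_of_hasLaw_gamma one_pos hE hr hs)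
  set A : ℕ → Set (ℕ → ℝ) := fun M =>
    {ω | (∀ n, 0 ≤ ω n) ∧ x < ∑ n ∈ Finset.range M, ω n / r n} with hA
  have hmono : Monotone A := fun M N hMN ω hω =>
    ⟨hω.1, hω.2.trans_le (Finset.sum_le_sum_of_subset_of_nonneg
      (Finset.range_mono hMN) fun n _ _ => div_nonneg (hω.1 n) (hr n).le)⟩
  have h3 : P.real {ω | x < ∑' n, ω n / r n} = P.real (⋃ M, A M) := by
    refine measureReal_congr ?_
    filter_upwards [hgood] with ω hω
    refine propext ⟨fun h : x < _ => ?_, fun h => ?_⟩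
    · obtain ⟨M, hM⟩ := (hω.2.hasSum.tendsto_sum_nat.eventually (lt_mem_nhds h)).exists
      exact mem_iUnion.2 ⟨M, hω.1, hM⟩
    · obtain ⟨M, hM⟩ := mem_iUnion.1 h
      exact hM.2.trans_le (hω.2.sum_le_tsum _ fun n _ => div_nonneg (hω.1 n) (hr n).le)
  rw [h3]
  refine ((ENNReal.tendsto_toReal (measure_ne_top _ _)).comp
    (tendsto_measure_iUnion_atTop (μ := P) hmono)).congr' ?_
  filter_upwards [eventually_ne_atTop 0] with M hM
  rw [h1 M hM]
  refine measureReal_congr ?_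
  filter_upwards [hgood] with ω hω
  exact propext ⟨fun h => h.2, fun h => ⟨hω.1, h⟩⟩

end Hypoexponential

end

noncomputable section

/-! ### The rates and the mixture weights in terms of q-numbers -/

section QNumbers

/-- The `q`-analogue `1 + q + ⋯ + q ^ (k - 1)` of `k`. -/
def qnum (q : ℝ) (k : ℕ) : ℝ := ∑ i ∈ Finset.range k, q ^ i

/-- The `q`-factorial. -/
def qfact (q : ℝ) (n : ℕ) : ℝ := ∏ i ∈ Finset.range n, qnum q (i + 1)

variable {q : ℝ}

lemma qnum_succ (q : ℝ) (k : ℕ) : qnum q (k + 1) = qnum q k + q ^ k := Finset.sum_range_succ _ _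

lemma qnum_one (q : ℝ) : qnum q 1 = 1 := by simp [qnum]

lemma one_sub_mul_qnum (q : ℝ) (k : ℕ) : (1 - q) * qnum q k = 1 - q ^ k := mul_neg_geom_sum q k

lemma qnum_add (q : ℝ) (a b : ℕ) : qnum q (a + b) = qnum q a + q ^ a * qnum q b := by
  rw [qnum, Finset.sum_range_add, qnum, qnum, Finset.mul_sum]
  simp_rw [pow_add]

lemma qnum_pos (hq : 0 < q) (k : ℕ) : 0 < qnum q (k + 1) :=
  Finset.sum_pos (fun _ _ => by positivity) (by simp)

lemma qnum_nonneg (hq : 0 < q) (k : ℕ) : 0 ≤ qnum q k :=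
  Finset.sum_nonneg fun _ _ => by positivity

lemma qnum_le (hq : 0 < q) (hq1 : q ≤ 1) (k : ℕ) : qnum q k ≤ k := by
  refine (Finset.sum_le_card_nsmul _ _ 1 fun i _ => pow_le_one₀ hq.le hq1).trans ?_
  simp

lemma mul_pow_le_qnum (hq : 0 < q) (hq1 : q ≤ 1) (k : ℕ) : k * q ^ k ≤ qnum q k := by
  have h := Finset.card_nsmul_le_sum (Finset.range k) (fun i => q ^ i) (q ^ k)
    fun i hi => pow_le_pow_of_le_one hq.le hq1 (Finset.mem_range.1 hi).le
  simpa [qnum] using h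

lemma qnum_le_qnum_add (hq : 0 < q) (a b : ℕ) : qnum q a ≤ qnum q (a + b) := by
  rw [qnum_add]
  have := qnum_nonneg hq b
  have : 0 ≤ q ^ a * qnum q b := by positivity
  linarith

lemma qnum_one_left (k : ℕ) : qnum 1 k = k := by simp [qnum]

lemma qfact_succ (q : ℝ) (n : ℕ) : qfact q (n + 1) = qfact q n * qnum q (n + 1) :=
  Finset.prod_range_succ _ _

lemma qfact_pos (hq : 0 < q) (n : ℕ) : 0 < qfact q n :=
  Finset.prod_pos fun i _ => qnum_pos hq i

lemma qfact_add (q : ℝ) (a b : ℕ) :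
    qfact q (a + b) = qfact q a * ∏ j ∈ Finset.range b, qnum q (a + j + 1) :=
  Finset.prod_range_add _ _ _

lemma sq_mul_pow_le_qnum_sq (hq : 0 < q) (k : ℕ) :
    ((k : ℝ) + 1) ^ 2 * q ^ k ≤ qnum q (k + 1) ^ 2 := by
  -- With `q = p²` the claim is the square of `(k + 1) p ^ k ≤ 1 + p² + ⋯ + p ^ (2k)`, an instance
  -- of the inequality of arithmetic and geometric means; the induction step is Bernoulli's
  -- inequality for `p ^ (k + 2)`.
  obtain ⟨p, hp, rfl⟩ : ∃ p, 0 < p ∧ p ^ 2 = q := ⟨√q, Real.sqrt_pos.2 hq, Real.sq_sqrt hq.le⟩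
  have h : ∀ k : ℕ, ((k : ℝ) + 1) * p ^ k ≤ qnum (p ^ 2) (k + 1) := by
    intro k
    induction k with
    | zero => simp [qnum]
    | succ k ih =>
      rw [qnum_succ]
      have hB := one_add_mul_le_pow (a := p - 1) (by linarith) (k + 2)
      have hpk : 0 < p ^ k := by positivity
      have := mul_le_mul_of_nonneg_left hB hpk.le
      push_cast at this ⊢
      rw [add_sub_cancel] at this
      have e1 : (p ^ 2) ^ (k + 1) = p ^ k * p ^ (k + 2) := by ring
      have e2 : p ^ (k + 1) = p ^ k * p := by ring
      rw [e1, e2]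
      nlinarith
  calc ((k : ℝ) + 1) ^ 2 * (p ^ 2) ^ k = (((k : ℝ) + 1) * p ^ k) ^ 2 := by ring
    _ ≤ _ := pow_le_pow_left₀ (by positivity) (h k) 2

/-- The ratio falls short of `1` by `q ^ (k + 1) * qnum q d / qnum q (k + 1 + d)`, which is at most
`d / (k + 1)`. This argument covers `q = 1` together with `q < 1`. -/
lemma tendsto_qnum_div_qnum_add (hq : 0 < q) (hq1 : q ≤ 1) (d : ℕ) :
    Tendsto (fun k : ℕ => qnum q (k + 1) / qnum q (k + 1 + d)) atTop (𝓝 1) := by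
  have h : Tendsto (fun k : ℕ => 1 - (d : ℝ) * (1 / ((k : ℝ) + 1))) atTop (𝓝 1) := by
    simpa using (tendsto_one_div_add_atTop_nhds_zero_nat (𝕜 := ℝ)).const_mul (d : ℝ) |>.const_sub 1
  refine tendsto_of_tendsto_of_tendsto_of_le_of_le h tendsto_const_nhds (fun k => ?_) fun k => ?_
  · have h1 := qnum_pos hq k
    have h2 : 0 < qnum q (k + 1 + d) := by
      rw [add_right_comm]; exact qnum_pos hq (k + d)
    change 1 - (d : ℝ) * (1 / ((k : ℝ) + 1)) ≤ qnum q (k + 1) / qnum q (k + 1 + d)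
    rw [le_div_iff₀ h2]
    have h3 := mul_pow_le_qnum hq hq1 (k + 1)
    have h4 := qnum_le hq hq1 d
    have hk : (0 : ℝ) < (k : ℝ) + 1 := by positivity
    have hle := qnum_le_qnum_add hq (k + 1) d
    have h5 : q ^ (k + 1) * qnum q d ≤ d * (1 / ((k : ℝ) + 1)) * qnum q (k + 1 + d) := by
      calc q ^ (k + 1) * qnum q d ≤ (1 / ((k : ℝ) + 1) * qnum q (k + 1)) * d := by
            refine mul_le_mul ?_ h4 (qnum_nonneg hq d) (by positivity)
            push_cast at h3
            rw [one_div_mul_eq_div, le_div_iff₀ hk]; linarith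
        _ ≤ (1 / ((k : ℝ) + 1) * qnum q (k + 1 + d)) * d := by gcongr
        _ = _ := by ring
    have h6 := qnum_add q (k + 1) d
    nlinarith
  · have h2 : 0 < qnum q (k + 1 + d) := by
      rw [add_right_comm]; exact qnum_pos hq (k + d)
    exact (div_le_one h2).2 (qnum_le_qnum_add hq (k + 1) d)

/-- The rates of the exponential summands of the scaled total workload. -/
def summandRate (C q : ℝ) (n : ℕ) : ℝ := C * (1 + q) * qnum q (n + 1) * qnum q (n + 2) / q ^ (n + 1)

variable {C : ℝ}

/-- The `q`-analogue of `(n + d + 1)(n + d + 2) - (n + 1)(n + 2) = d (2n + d + 3)`. That the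
differences are again products of `q`-numbers is what gives the partial fraction weights a closed
form. -/
lemma summandRate_sub (hq : 0 < q) (n d : ℕ) :
    summandRate C q (n + d) - summandRate C q n =
      C * (1 + q) * qnum q d * qnum q (2 * n + d + 3) / q ^ (n + d + 1) := by
  have ha := one_sub_mul_qnum q (n + 1)
  have hD := one_sub_mul_qnum q d
  have e1 : qnum q (n + d + 1) = qnum q d + q ^ d * qnum q (n + 1) := by
    rw [← qnum_add]; congr 1; ring
  have e2 : qnum q (n + d + 2) = qnum q d + q ^ d * qnum q (n + 2) := by
    rw [← qnum_add]; congr 1; ring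
  have e3 : qnum q (2 * n + d + 3) =
      qnum q d + q ^ d * (qnum q (n + 1) + q ^ (n + 1) * qnum q (n + 2)) := by
    rw [← qnum_add, ← qnum_add]; congr 1; ring
  have e4 : q ^ (n + d + 1) = q ^ d * q ^ (n + 1) := by ring
  rw [summandRate, summandRate, e1, e2, e3, e4, sub_eq_iff_eq_add,
    show C * (1 + q) * qnum q (n + 1) * qnum q (n + 2) / q ^ (n + 1) =
      q ^ d * (C * (1 + q) * qnum q (n + 1) * qnum q (n + 2)) / (q ^ d * q ^ (n + 1)) from
      (mul_div_mul_left _ _ (by positivity)).symm, ← add_div]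
  congr 1
  -- Eliminating the powers of `q` leaves a polynomial identity in `q` and three `q`-numbers.
  have hqd : q ^ d = 1 - (1 - q) * qnum q d := by linarith
  have hqn : q ^ (n + 1) = 1 - (1 - q) * qnum q (n + 1) := by linarith
  rw [hqd, hqn]
  ring

lemma summandRate_pos (hC : 0 < C) (hq : 0 < q) (n : ℕ) : 0 < summandRate C q n := by
  have := qnum_pos hq n
  have := qnum_pos hq (n + 1)
  unfold summandRate
  positivity

lemma summandRate_strictMono (hC : 0 < C) (hq : 0 < q) : StrictMono (summandRate C q) := by
  refine strictMono_nat_of_lt_succ fun n => ?_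
  rw [← sub_pos, summandRate_sub hq]
  have := qnum_pos hq 0
  have := qnum_pos hq (2 * n + 1 + 2)
  positivity

/-- The bound does not involve `q`; this uniformity allows every later passage to the limit `q ↑ 1`.
-/
lemma le_summandRate (hC : 0 < C) (hq : 0 < q) (hq1 : q ≤ 1) (n : ℕ) :
    C * ((n : ℝ) + 1) ^ 2 ≤ summandRate C q n := by
  rw [summandRate, le_div_iff₀ (by positivity)]
  have h1 := sq_mul_pow_le_qnum_sq hq n
  have h2 : q ^ (n + 1) ≤ q ^ n := pow_le_pow_of_le_one hq.le hq1 (Nat.le_succ n)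
  have h3 : qnum q (n + 1) ≤ qnum q (n + 2) := by
    rw [qnum_succ q (n + 1)]; linarith [pow_pos hq (n + 1)]
  have h4 := qnum_pos hq n
  have h5 := qnum_pos hq (n + 1)
  calc C * ((n : ℝ) + 1) ^ 2 * q ^ (n + 1) ≤ C * (((n : ℝ) + 1) ^ 2 * q ^ n) := by
        rw [mul_assoc]; gcongr
    _ ≤ C * (qnum q (n + 1) * qnum q (n + 2)) := by
        refine mul_le_mul_of_nonneg_left (h1.trans ?_) hC.le
        rw [sq]; gcongr
    _ ≤ (1 + q) * (C * (qnum q (n + 1) * qnum q (n + 2))) := by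
        have : 0 ≤ C * (qnum q (n + 1) * qnum q (n + 2)) := by positivity
        nlinarith
    _ = _ := by ring

lemma mul_le_summandRate (hC : 0 < C) (hq : 0 < q) (hq1 : q ≤ 1) (n : ℕ) :
    C * ((n : ℝ) + 1) ≤ summandRate C q n := by
  refine le_trans ?_ (le_summandRate hC hq hq1 n)
  have : (0 : ℝ) ≤ n := by positivity
  nlinarith [mul_nonneg hC.le (mul_nonneg this this), mul_nonneg hC.le this]

lemma summable_inv_mul_add_one_sq (C : ℝ) : Summable fun n : ℕ => (C * ((n : ℝ) + 1) ^ 2)⁻¹ := by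
  simp_rw [mul_inv]
  refine Summable.mul_left _ ?_
  have := (summable_nat_add_iff 1).2 (Real.summable_nat_pow_inv.2 one_lt_two)
  simpa using this

lemma summable_inv_summandRate (hC : 0 < C) (hq : 0 < q) (hq1 : q ≤ 1) :
    Summable fun n => (summandRate C q n)⁻¹ :=
  (summable_inv_mul_add_one_sq C).of_nonneg_of_le
    (fun n => inv_nonneg.2 (summandRate_pos hC hq n).le)
    fun n => inv_anti₀ (by positivity) (le_summandRate hC hq hq1 n)

/-- The limits of the hypoexponential weights. -/
def limitWeight (q : ℝ) (n : ℕ) : ℝ :=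
  (-1) ^ n * q ^ (∑ i ∈ Finset.range n, (i + 1)) * qnum q (2 * n + 3)

lemma abs_limitWeight_le (hq : 0 < q) (hq1 : q ≤ 1) (n : ℕ) :
    |limitWeight q n| ≤ 2 * n + 3 := by
  rw [limitWeight, abs_mul, abs_mul, abs_pow, abs_neg, abs_one, one_pow, one_mul,
    abs_of_pos (by positivity), abs_of_nonneg (qnum_nonneg hq _)]
  have h1 := qnum_le hq hq1 (2 * n + 3)
  push_cast at h1
  exact (mul_le_of_le_one_left (qnum_nonneg hq _) (pow_le_one₀ hq.le hq1)).trans h1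

/-- Only rates below the `n`-th enter here. Each factor is negative and carries `q ^ (n - m)`,
whence the sign and the triangular exponent in `limitWeight`. -/
lemma hypoexpWeight_self (hC : 0 < C) (hq : 0 < q) (n : ℕ) :
    hypoexpWeight (summandRate C q) (n + 1) n =
      limitWeight q n * (qfact q (n + 2) * qfact q (n + 1) / qfact q (2 * n + 3)) := by
  have hterm : ∀ m ∈ Finset.range n, summandRate C q m / (summandRate C q m - summandRate C q n) =
      (-1) * q ^ (n - m) * (qnum q (m + 1) * qnum q (m + 1 + 1)) /
        (qnum q (n - m) * qnum q (n + 2 + m + 1)) := by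
    intro m hm
    obtain ⟨d, rfl⟩ := Nat.exists_eq_add_of_lt (Finset.mem_range.1 hm)
    have h := summandRate_sub (C := C) hq m (d + 1)
    rw [← add_assoc] at h
    rw [← neg_sub, h, show m + d + 1 - m = d + 1 by omega,
      show m + d + 1 + 2 + m + 1 = 2 * m + (d + 1) + 3 by ring, summandRate]
    have h1 := qnum_pos hq d
    have h2 := qnum_pos hq (2 * m + (d + 1) + 2)
    have h3 : q ^ (m + d + 1 + 1) = q ^ (d + 1) * q ^ (m + 1) := by ring
    rw [h3]
    field_simp
  have hn : (Finset.range (n + 1)).erase n = Finset.range n := by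
    rw [Finset.range_add_one, Finset.erase_insert Finset.notMem_range_self]
  rw [hypoexpWeight, hn, Finset.prod_congr rfl hterm, Finset.prod_div_distrib,
    Finset.prod_mul_distrib, Finset.prod_mul_distrib, Finset.prod_mul_distrib,
    Finset.prod_mul_distrib]
  have r1 : ∏ m ∈ Finset.range n, q ^ (n - m) = q ^ (∑ i ∈ Finset.range n, (i + 1)) := by
    rw [← Finset.prod_pow_eq_pow_sum, ← Finset.prod_range_reflect]
    refine Finset.prod_congr rfl fun m hm => ?_
    rw [Finset.mem_range] at hm
    congr 1; omega
  have r2 : ∏ m ∈ Finset.range n, qnum q (n - m) = qfact q n := by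
    rw [qfact, ← Finset.prod_range_reflect]
    refine Finset.prod_congr rfl fun m hm => ?_
    rw [Finset.mem_range] at hm
    congr 1; omega
  have r3 : ∏ m ∈ Finset.range n, qnum q (m + 1 + 1) = qfact q (n + 1) := by
    rw [qfact, Finset.prod_range_succ', qnum_one, mul_one]
  have r4 := qfact_add q (n + 2) n
  have r5 : qfact q (2 * n + 3) = qfact q (n + 2 + n) * qnum q (2 * n + 3) := by
    rw [show 2 * n + 3 = n + 2 + n + 1 by ring, qfact_succ]
  have r6 : ∏ m ∈ Finset.range n, qnum q (m + 1) = qfact q n := rfl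
  rw [r1, r2, r3, r5, r4, r6, limitWeight, Finset.prod_const, Finset.card_range]
  have p1 := qfact_pos hq n
  have p2 := qfact_pos hq (n + 2)
  have p3 := qnum_pos hq (2 * n + 2)
  have p4 : 0 < ∏ j ∈ Finset.range n, qnum q (n + 2 + j + 1) :=
    Finset.prod_pos fun j _ => qnum_pos hq _
  field_simp

/-- Each further rate, of index `n + k + 1`, contributes one factor, which updates the
`q`-factorials by one step. -/
lemma hypoexpWeight_add (hC : 0 < C) (hq : 0 < q) (n k : ℕ) :
    hypoexpWeight (summandRate C q) (n + 1 + k) n =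
      limitWeight q n * (qfact q (n + 2 + k) * qfact q (n + 1 + k) /
        (qfact q (2 * n + 3 + k) * qfact q k)) := by
  induction k with
  | zero => rw [add_zero, hypoexpWeight_self hC hq]; simp [qfact]
  | succ k ih =>
    have h := summandRate_sub (C := C) hq n (k + 1)
    rw [hypoexpWeight, ← add_assoc, Finset.range_add_one, Finset.erase_insert_of_ne (by omega),
      Finset.prod_insert (by simp), ← hypoexpWeight, ih, show n + 1 + k = n + (k + 1) by ring, h,
      summandRate, ← add_assoc (n + 2), ← add_assoc (2 * n + 3), qfact_succ q k,
      qfact_succ q (n + 2 + k), qfact_succ q (2 * n + 3 + k), ← add_assoc n, qfact_succ q (n + k + 1),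
      show 2 * n + (k + 1) + 3 = 2 * n + 3 + k + 1 by ring,
      show n + k + 1 + 2 = n + 2 + k + 1 by ring]
    have p1 := qnum_pos hq k
    have p2 := qnum_pos hq (2 * n + 3 + k)
    have p3 := qfact_pos hq k
    have p4 := qfact_pos hq (2 * n + 3 + k)
    field_simp

/-- In this form the factors are at most `1` and tend to `1` as `k → ∞` with `n` fixed, so both the
bound and the limit of the weights can be read off. -/
lemma qfact_ratio_eq_prod (hq : 0 < q) (n k : ℕ) :
    qfact q (n + 2 + k) * qfact q (n + 1 + k) / (qfact q (2 * n + 3 + k) * qfact q k) =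
      ∏ j ∈ Finset.range (n + 1), qnum q (k + j + 1) / qnum q (k + j + 1 + (n + 2)) := by
  have h1 := qfact_add q k (n + 1)
  have h2 := qfact_add q (n + 2 + k) (n + 1)
  have h3 : ∏ j ∈ Finset.range (n + 1), qnum q (n + 2 + k + j + 1) =
      ∏ j ∈ Finset.range (n + 1), qnum q (k + j + 1 + (n + 2)) :=
    Finset.prod_congr rfl fun j _ => by congr 1; ring
  rw [h3] at h2
  rw [show n + 1 + k = k + (n + 1) by ring, show 2 * n + 3 + k = n + 2 + k + (n + 1) by ring, h1, h2,
    Finset.prod_div_distrib]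
  have p1 := qfact_pos hq k
  have p2 := qfact_pos hq (n + 2 + k)
  field_simp

lemma abs_hypoexpWeight_le (hC : 0 < C) (hq : 0 < q) (hq1 : q ≤ 1) {n M : ℕ} (h : n < M) :
    |hypoexpWeight (summandRate C q) M n| ≤ 2 * n + 3 := by
  obtain ⟨k, rfl⟩ := Nat.exists_eq_add_of_le (Nat.succ_le_of_lt h)
  rw [Nat.succ_eq_add_one, hypoexpWeight_add hC hq, qfact_ratio_eq_prod hq, abs_mul]
  refine (mul_le_of_le_one_right (abs_nonneg _) ?_).trans (abs_limitWeight_le hq hq1 n)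
  rw [Finset.abs_prod]
  refine Finset.prod_le_one (fun _ _ => abs_nonneg _) fun j _ => ?_
  have h1 := qnum_pos hq (k + j)
  have h2 := qnum_le_qnum_add hq (k + j + 1) (n + 2)
  rw [abs_of_nonneg (div_nonneg h1.le (h1.le.trans h2))]
  exact (div_le_one (h1.trans_le h2)).2 h2

lemma tendsto_hypoexpWeight (hC : 0 < C) (hq : 0 < q) (hq1 : q ≤ 1) (n : ℕ) :
    Tendsto (fun M => hypoexpWeight (summandRate C q) M n) atTop (𝓝 (limitWeight q n)) := by
  rw [← tendsto_add_atTop_iff_nat (n + 1)]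
  simp_rw [add_comm _ (n + 1), hypoexpWeight_add hC hq, qfact_ratio_eq_prod hq]
  have h : ∀ j ∈ Finset.range (n + 1), Tendsto (fun k =>
      qnum q (k + j + 1) / qnum q (k + j + 1 + (n + 2))) atTop (𝓝 1) := fun j _ =>
    (tendsto_qnum_div_qnum_add hq hq1 (n + 2)).comp (tendsto_add_atTop_nat j)
  simpa using (tendsto_finsetProd _ h).const_mul (limitWeight q n)

end QNumbers

end

noncomputable section

/-! ### The density as a signed mixture of exponential densities -/

section Density

variable {C q x : ℝ}

/-- The terms of the density of the scaled total workload. -/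
def mixtureTerm (C q x : ℝ) (n : ℕ) : ℝ :=
  limitWeight q n * (summandRate C q n * Real.exp (-(summandRate C q n * x)))

/-- The density of the scaled total workload. -/
def mixtureDensity (C q x : ℝ) : ℝ := ∑' n, mixtureTerm C q x n

/-- A summable bound of the terms of the density, uniform in `q` and locally uniform in `x`. -/
def mixtureBound (C x : ℝ) (n : ℕ) : ℝ :=
  (2 * n + 3) * (2 / x * Real.exp (-(C * ((n : ℝ) + 1) * (x / 2))))

lemma summable_linear_mul_exp {b : ℝ} (hb : 0 < b) :
    Summable fun n : ℕ => (2 * (n : ℝ) + 3) * Real.exp (-(b * ((n : ℝ) + 1))) := by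
  have h1 := Real.summable_pow_mul_exp_neg_nat_mul 1 hb
  have h0 := Real.summable_pow_mul_exp_neg_nat_mul 0 hb
  refine (((h1.mul_left 2).add (h0.mul_left 3)).mul_right (Real.exp (-b))).congr fun n => ?_
  rw [show -(b * ((n : ℝ) + 1)) = -b * n + -b by ring, Real.exp_add]
  ring

lemma summable_mixtureBound (hC : 0 < C) (hx : 0 < x) : Summable (mixtureBound C x) := by
  have h := (summable_linear_mul_exp (b := C * (x / 2)) (by positivity)).mul_left (2 / x)
  refine h.congr fun n => ?_
  rw [mixtureBound, show C * ((n : ℝ) + 1) * (x / 2) = C * (x / 2) * (n + 1) by ring]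
  ring

/-- Half of the exponent absorbs the prefactor `s`. What remains decreases in `s`, so a lower bound
on the rates suffices to dominate the terms. -/
lemma mul_exp_neg_mul_le {s : ℝ} (hx : 0 < x) :
    s * Real.exp (-(s * x)) ≤ 2 / x * Real.exp (-(s * (x / 2))) := by
  have h := Real.add_one_le_exp (s * (x / 2))
  have h2 : s ≤ 2 / x * Real.exp (s * (x / 2)) := by
    rw [div_mul_eq_mul_div, le_div_iff₀ hx]; linarith
  calc s * Real.exp (-(s * x)) ≤ 2 / x * Real.exp (s * (x / 2)) * Real.exp (-(s * x)) := by gcongr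
    _ = _ := by
      rw [mul_assoc, ← Real.exp_add]; congr 2; ring

lemma abs_mixtureTerm_le (hC : 0 < C) (hq : 0 < q) (hq1 : q ≤ 1) {y : ℝ} (hx : 0 < x)
    (hxy : x ≤ y) (n : ℕ) : |mixtureTerm C q y n| ≤ mixtureBound C x n := by
  have hr := summandRate_pos hC hq n
  rw [mixtureTerm, abs_mul, abs_of_pos (by positivity : 0 < summandRate C q n * _), mixtureBound]
  refine mul_le_mul (abs_limitWeight_le hq hq1 n) ?_ (by positivity) (by positivity)
  calc summandRate C q n * Real.exp (-(summandRate C q n * y))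
      ≤ summandRate C q n * Real.exp (-(summandRate C q n * x)) := by gcongr
    _ ≤ 2 / x * Real.exp (-(summandRate C q n * (x / 2))) := mul_exp_neg_mul_le hx
    _ ≤ _ := by
      have := mul_le_summandRate hC hq hq1 n
      gcongr

lemma summable_mixtureTerm (hC : 0 < C) (hq : 0 < q) (hq1 : q ≤ 1) (hx : 0 < x) :
    Summable (mixtureTerm C q x) :=
  (summable_mixtureBound hC hx).of_norm_bounded (abs_mixtureTerm_le hC hq hq1 hx le_rfl)

lemma continuousOn_mixtureDensity (hC : 0 < C) (hq : 0 < q) (hq1 : q ≤ 1) :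
    ContinuousOn (mixtureDensity C q) (Ioi 0) := by
  intro x hx
  have hx2 : 0 < x / 2 := half_pos hx
  have h : ContinuousOn (mixtureDensity C q) (Ioi (x / 2)) :=
    continuousOn_tsum (fun n => by unfold mixtureTerm; fun_prop)
      (summable_mixtureBound hC hx2)
      fun n y hy => abs_mixtureTerm_le hC hq hq1 hx2 (le_of_lt hy) n
  exact (h.continuousAt (Ioi_mem_nhds (half_lt_self hx))).continuousWithinAt

lemma tendsto_mixtureDensity {ι : Type*} {l : Filter ι} (hC : 0 < C) (hx : 0 < x) {Q : ι → ℝ}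
    (hQ : ∀ᶠ i in l, 0 < Q i ∧ Q i ≤ 1) (hlim : Tendsto Q l (𝓝 1)) :
    Tendsto (fun i => mixtureDensity C (Q i) x) l (𝓝 (mixtureDensity C 1 x)) := by
  refine tendsto_tsum_of_dominated_convergence (summable_mixtureBound hC hx) (fun n => ?_) ?_
  · have hc : ContinuousAt (fun q => mixtureTerm C q x n) 1 := by
      unfold mixtureTerm limitWeight summandRate qnum
      fun_prop (disch := simp)
    exact hc.tendsto.comp hlim
  · filter_upwards [hQ] with i hi n using abs_mixtureTerm_le hC hi.1 hi.2 hx le_rfl n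

lemma tendsto_summandRate {ι : Type*} {l : Filter ι} {Q : ι → ℝ} (hlim : Tendsto Q l (𝓝 1))
    (n : ℕ) : Tendsto (fun i => summandRate C (Q i) n) l (𝓝 (summandRate C 1 n)) := by
  have hc : ContinuousAt (fun q => summandRate C q n) 1 := by
    unfold summandRate qnum
    fun_prop (disch := simp)
  exact hc.tendsto.comp hlim

lemma summable_abs_limitWeight_mul_exp (hC : 0 < C) (hq : 0 < q) (hq1 : q ≤ 1) (hx : 0 < x) :
    Summable fun n => |limitWeight q n| * Real.exp (-(summandRate C q n * x)) := by
  refine (summable_linear_mul_exp (b := C * x) (by positivity)).of_nonneg_of_le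
    (fun n => by positivity) fun n => ?_
  have := mul_le_summandRate hC hq hq1 n
  refine mul_le_mul (abs_limitWeight_le hq hq1 n) ?_ (by positivity) (by positivity)
  rw [show C * x * ((n : ℝ) + 1) = C * (n + 1) * x by ring]
  gcongr

/-- Let `M → ∞` in the finite tail formula: the weights converge and, being at most `2n + 3` in
absolute value, are dominated thanks to the exponential factor, which needs `x > 0`. -/
theorem gammaSeriesLaw_real_Ioi (hC : 0 < C) (hq : 0 < q) (hq1 : q ≤ 1) (hx : 0 < x) :
    (gammaSeriesLaw 1 (summandRate C q)).real (Ioi x) =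
      ∑' n, limitWeight q n * Real.exp (-(summandRate C q n * x)) := by
  refine tendsto_nhds_unique (tendsto_sum_hypoexpWeight (summandRate_pos hC hq)
    (summandRate_strictMono hC hq).injective (summable_inv_summandRate hC hq hq1) hx.le) ?_
  have h : ∀ M, ∑ n ∈ Finset.range M,
      hypoexpWeight (summandRate C q) M n * Real.exp (-(summandRate C q n * x)) =
      ∑' n, if n < M then
        hypoexpWeight (summandRate C q) M n * Real.exp (-(summandRate C q n * x)) else 0 := fun M => by
    rw [tsum_eq_sum (s := Finset.range M) (fun n hn => if_neg (by simpa using hn))]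
    exact Finset.sum_congr rfl fun n hn => (if_pos (Finset.mem_range.1 hn)).symm
  simp_rw [h]
  refine tendsto_tsum_of_dominated_convergence
    (summable_linear_mul_exp (b := C * x) (by positivity)) (fun n => ?_) ?_
  · refine ((tendsto_hypoexpWeight hC hq hq1 n).mul_const _).congr' ?_
    filter_upwards [eventually_gt_atTop n] with M hM
    rw [if_pos hM]
  · refine Eventually.of_forall fun M n => ?_
    split_ifs with hn
    · rw [norm_mul, Real.norm_eq_abs, Real.norm_eq_abs, Real.abs_exp]
      have := mul_le_summandRate hC hq hq1 n
      refine mul_le_mul (abs_hypoexpWeight_le hC hq hq1 hn) ?_ (by positivity) (by positivity)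
      rw [show C * x * ((n : ℝ) + 1) = C * (n + 1) * x by ring]
      gcongr
    · rw [norm_zero]; positivity

lemma integrableOn_mixtureTerm (hC : 0 < C) (hq : 0 < q) (n : ℕ) :
    IntegrableOn (fun y => mixtureTerm C q y n) (Ioi x) := by
  have h := integrableOn_exp_mul_Ioi (neg_neg_of_pos (summandRate_pos hC hq n)) x
  refine ((h.const_mul (summandRate C q n)).const_mul (limitWeight q n)).congr
    (ae_of_all _ fun y => ?_)
  simp [mixtureTerm]

lemma integral_rate_mul_exp {s : ℝ} (hs : 0 < s) (x : ℝ) :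
    ∫ y in Ioi x, s * Real.exp (-(s * y)) = Real.exp (-(s * x)) := by
  have h := integral_exp_mul_Ioi (neg_neg_of_pos hs) x
  simp only [neg_mul] at h
  rw [integral_const_mul, h]
  field_simp

lemma hasSum_integral_mixtureTerm (hC : 0 < C) (hq : 0 < q) (hq1 : q ≤ 1) (hx : 0 < x) :
    HasSum (fun n => ∫ y in Ioi x, mixtureTerm C q y n) (∫ y in Ioi x, mixtureDensity C q y) := by
  refine hasSum_integral_of_summable_integral_norm
    (fun n => integrableOn_mixtureTerm hC hq n) ?_
  refine (summable_abs_limitWeight_mul_exp hC hq hq1 hx).congr fun n => ?_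
  rw [← integral_rate_mul_exp (summandRate_pos hC hq n), ← integral_const_mul]
  congr 1; funext y
  have hr := summandRate_pos hC hq n
  rw [mixtureTerm, norm_mul, Real.norm_eq_abs, Real.norm_of_nonneg (by positivity)]

lemma integral_mixtureDensity (hC : 0 < C) (hq : 0 < q) (hq1 : q ≤ 1) (hx : 0 < x) :
    ∫ y in Ioi x, mixtureDensity C q y = (gammaSeriesLaw 1 (summandRate C q)).real (Ioi x) := by
  rw [gammaSeriesLaw_real_Ioi hC hq hq1 hx, ← (hasSum_integral_mixtureTerm hC hq hq1 hx).tsum_eq]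
  congr 1; funext n
  unfold mixtureTerm
  rw [integral_const_mul, integral_rate_mul_exp (summandRate_pos hC hq n)]

lemma integrableOn_mixtureDensity (hC : 0 < C) (hq : 0 < q) (hq1 : q ≤ 1) (hx : 0 < x) :
    IntegrableOn (mixtureDensity C q) (Ioi x) := by
  refine ⟨((continuousOn_mixtureDensity hC hq hq1).mono
    (Ioi_subset_Ioi hx.le)).aestronglyMeasurable measurableSet_Ioi, ?_⟩
  have hint := fun n => integrableOn_mixtureTerm (x := x) hC hq n
  calc ∫⁻ y in Ioi x, ‖mixtureDensity C q y‖ₑ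
      ≤ ∫⁻ y in Ioi x, ∑' n, ‖mixtureTerm C q y n‖ₑ := by
        refine setLIntegral_mono' measurableSet_Ioi fun y hy => ?_
        exact enorm_tsum_le_tsum_enorm
    _ = ∑' n, ∫⁻ y in Ioi x, ‖mixtureTerm C q y n‖ₑ :=
        lintegral_tsum fun n => (hint n).aestronglyMeasurable.enorm
    _ = ∑' n, ENNReal.ofReal (|limitWeight q n| * Real.exp (-(summandRate C q n * x))) := by
        congr 1; funext n
        rw [← ofReal_integral_norm_eq_lintegral_enorm (hint n)]
        congr 1
        rw [← integral_rate_mul_exp (summandRate_pos hC hq n), ← integral_const_mul]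
        congr 1; funext y
        have hr := summandRate_pos hC hq n
        rw [mixtureTerm, norm_mul, Real.norm_eq_abs, Real.norm_of_nonneg (by positivity)]
    _ < ⊤ := by
        rw [← ENNReal.ofReal_tsum_of_nonneg (fun n => by positivity)
          (summable_abs_limitWeight_mul_exp hC hq hq1 hx)]
        exact ENNReal.ofReal_lt_top

/-- The terms alternate in sign, so the reason is probabilistic: integrals over `(x, b]` are
differences of tail probabilities, and a continuous function that is negative at a point would
violate this nearby. -/
lemma mixtureDensity_nonneg (hC : 0 < C) (hq : 0 < q) (hq1 : q ≤ 1) (hx : 0 < x) :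
    0 ≤ mixtureDensity C q x := by
  have := isProbabilityMeasure_gammaSeriesLaw one_pos (summandRate_pos hC hq)
    (summable_inv_summandRate hC hq hq1)
  by_contra! hneg
  have hcont : ContinuousAt (mixtureDensity C q) x :=
    (continuousOn_mixtureDensity hC hq hq1).continuousAt (Ioi_mem_nhds hx)
  obtain ⟨l, u, ⟨hl, hu⟩, hlu⟩ := mem_nhds_iff_exists_Ioo_subset.1
    ((hcont.eventually (gt_mem_nhds hneg)).and (Ioi_mem_nhds hx))
  obtain ⟨b, hxb, hbu⟩ := exists_between hu
  have hb : 0 < b := hx.trans hxb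
  have hsub : Ioi x = Ioc x b ∪ Ioi b := (Ioc_union_Ioi_eq_Ioi hxb.le).symm
  have hint := integrableOn_mixtureDensity hC hq hq1 hx
  have h1 : ∫ y in Ioi x, mixtureDensity C q y =
      (∫ y in Ioc x b, mixtureDensity C q y) + ∫ y in Ioi b, mixtureDensity C q y := by
    rw [hsub, setIntegral_union (Ioc_disjoint_Ioi le_rfl) measurableSet_Ioi
      (hint.mono_set Ioc_subset_Ioi_self) (integrableOn_mixtureDensity hC hq hq1 hb)]
  rw [integral_mixtureDensity hC hq hq1 hx, integral_mixtureDensity hC hq hq1 hb] at h1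
  have h2 : (gammaSeriesLaw 1 (summandRate C q)).real (Ioi b) ≤
      (gammaSeriesLaw 1 (summandRate C q)).real (Ioi x) := measureReal_mono (Ioi_subset_Ioi hxb.le)
  have h3 : 0 < ∫ y in x..b, -mixtureDensity C q y := by
    refine intervalIntegral.intervalIntegral_pos_of_pos_on ?_ (fun y hy => ?_) hxb
    · rw [intervalIntegrable_iff_integrableOn_Ioc_of_le hxb.le]
      exact (hint.mono_set Ioc_subset_Ioi_self).neg
    · have := (hlu ⟨hl.trans hy.1, hy.2.trans hbu⟩).1
      simpa using this
  rw [intervalIntegral.integral_neg, intervalIntegral.integral_of_le hxb.le] at h3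
  linarith

theorem gammaSeriesLaw_eq_withDensity (hC : 0 < C) (hq : 0 < q) (hq1 : q ≤ 1) :
    gammaSeriesLaw 1 (summandRate C q) =
      (volume.restrict (Ioi 0)).withDensity fun x => ENNReal.ofReal (mixtureDensity C q x) := by
  have hprob := isProbabilityMeasure_gammaSeriesLaw one_pos (summandRate_pos hC hq)
    (summable_inv_summandRate hC hq hq1)
  set μ := gammaSeriesLaw 1 (summandRate C q)
  set ν := (volume.restrict (Ioi 0)).withDensity fun x => ENNReal.ofReal (mixtureDensity C q x)
  have hpos : ∀ x : ℝ, 0 < x → μ (Ioi x) = ν (Ioi x) := fun x hx => by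
    rw [withDensity_apply _ measurableSet_Ioi, Measure.restrict_restrict measurableSet_Ioi,
      inter_eq_left.2 (Ioi_subset_Ioi hx.le), ← ofReal_integral_eq_lintegral_ofReal
      (integrableOn_mixtureDensity hC hq hq1 hx), integral_mixtureDensity hC hq hq1 hx,
      ofReal_measureReal]
    filter_upwards [self_mem_ae_restrict measurableSet_Ioi] with y hy
    exact mixtureDensity_nonneg hC hq hq1 (hx.trans hy)
  -- The tail formula is available only for `x > 0`; the mass of the open half line is reached
  -- through the exhaustion by `(1 / (n + 1), ∞)`.
  have hseq : ⋃ n : ℕ, Ioi (1 / ((n : ℝ) + 1)) = Ioi 0 := by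
    ext y
    simp only [mem_iUnion, mem_Ioi]
    exact ⟨fun ⟨n, hn⟩ => lt_trans (by positivity) hn, fun hy => exists_nat_one_div_lt hy⟩
  have hmono : Monotone fun n : ℕ => Ioi (1 / ((n : ℝ) + 1)) := fun m n hmn =>
    Ioi_subset_Ioi (one_div_le_one_div_of_le (by positivity) (by gcongr))
  have hzero : μ (Ioi 0) = ν (Ioi 0) := by
    rw [← hseq]
    refine tendsto_nhds_unique (tendsto_measure_iUnion_atTop (μ := μ) hmono) ?_
    refine (tendsto_measure_iUnion_atTop (μ := ν) hmono).congr fun n => ?_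
    exact (hpos _ (by positivity)).symm
  have hμ0 : μ (Iic 0) = 0 := by
    have := ae_pos_gammaSeriesLaw one_pos (summandRate_pos hC hq)
      (summable_inv_summandRate hC hq hq1)
    rw [ae_iff] at this
    simp only [not_lt] at this
    exact this
  have hν0 : ν (Iic 0) = 0 := by
    rw [withDensity_apply _ measurableSet_Iic, Measure.restrict_restrict measurableSet_Iic]
    rw [Iic_inter_Ioi, Ioc_self, Measure.restrict_empty, lintegral_zero_measure]
  have hν : IsProbabilityMeasure ν := by
    constructor
    rw [← Iic_union_Ioi (a := (0 : ℝ)), measure_union (by simp) measurableSet_Ioi, hν0, ← hzero,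
      ← hμ0, ← measure_union (by simp) measurableSet_Ioi, Iic_union_Ioi, measure_univ]
  refine Measure.ext_of_Iic _ _ fun x => ?_
  rcases le_or_gt x 0 with hx | hx
  · rw [measure_mono_null (Iic_subset_Iic.2 hx) hμ0, measure_mono_null (Iic_subset_Iic.2 hx) hν0]
  · rw [← compl_Ioi, prob_compl_eq_one_sub measurableSet_Ioi,
      prob_compl_eq_one_sub measurableSet_Ioi, hpos x hx]

end Density

end

noncomputable section

/-! ### The equations for the joint transform over one visit -/

namespace FluidPolling

variable {c lam mu : ℝ} {ν : Measure (ℝ × ℝ)}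

/-- The law of the workloads at the end of an exponential visit to queue 1. -/
def afterFirst (c lam mu : ℝ) (ν : Measure (ℝ × ℝ)) : Measure (ℝ × ℝ) :=
  Measure.map (fun p : (ℝ × ℝ) × ℝ => serveFirst lam mu p.1 p.2) (ν.prod (expMeasure c))

/-- The law of the workloads at the end of an exponential visit to queue 2. -/
def afterSecond (c lam mu : ℝ) (ν : Measure (ℝ × ℝ)) : Measure (ℝ × ℝ) :=
  Measure.map (fun p : (ℝ × ℝ) × ℝ => serveSecond lam mu p.1 p.2) (ν.prod (expMeasure c))

/-- The joint Laplace transform of the workloads. -/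
def jointLaplace (ν : Measure (ℝ × ℝ)) (s₁ s₂ : ℂ) : ℂ :=
  ∫ v, Complex.exp (-(s₁ * v.1 + s₂ * v.2)) ∂ν

lemma measurable_serveFirst (lam mu : ℝ) :
    Measurable fun p : (ℝ × ℝ) × ℝ => serveFirst lam mu p.1 p.2 := by
  unfold serveFirst; fun_prop

lemma measurable_serveSecond (lam mu : ℝ) :
    Measurable fun p : (ℝ × ℝ) × ℝ => serveSecond lam mu p.1 p.2 := by
  unfold serveSecond; fun_prop

lemma measurable_workloadAt (lam mu : ℝ) :
    Measurable fun p : Cycle × ℝ => workloadAt lam mu p.1 p.2 := by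
  unfold workloadAt serveSecond serveFirst
  refine Measurable.ite (measurableSet_le (by fun_prop) (by fun_prop)) (by fun_prop) (by fun_prop)

lemma measurableSet_nonneg : MeasurableSet {v : ℝ × ℝ | 0 ≤ v.1 ∧ 0 ≤ v.2} :=
  (measurableSet_le measurable_const measurable_fst).inter
    (measurableSet_le measurable_const measurable_snd)

lemma isProbabilityMeasure_afterFirst (hc : 0 < c) [IsProbabilityMeasure ν] :
    IsProbabilityMeasure (afterFirst c lam mu ν) := by
  have := isProbabilityMeasure_expMeasure hc
  exact Measure.isProbabilityMeasure_map (measurable_serveFirst lam mu).aemeasurable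

lemma ae_nonneg_prod (hc : 0 < c) [IsProbabilityMeasure ν] (hν : ∀ᵐ v ∂ν, 0 ≤ v.1 ∧ 0 ≤ v.2) :
    ∀ᵐ p : (ℝ × ℝ) × ℝ ∂ν.prod (expMeasure c), (0 ≤ p.1.1 ∧ 0 ≤ p.1.2) ∧ 0 ≤ p.2 := by
  have := isProbabilityMeasure_expMeasure hc
  exact (Measure.quasiMeasurePreserving_fst.ae hν).and
    (Measure.quasiMeasurePreserving_snd.ae (ae_nonneg_expMeasure c))

lemma ae_nonneg_afterFirst (hc : 0 < c) (hlam : 0 < lam) [IsProbabilityMeasure ν]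
    (hν : ∀ᵐ v ∂ν, 0 ≤ v.1 ∧ 0 ≤ v.2) : ∀ᵐ v ∂afterFirst c lam mu ν, 0 ≤ v.1 ∧ 0 ≤ v.2 := by
  rw [afterFirst, ae_map_iff (measurable_serveFirst lam mu).aemeasurable
    measurableSet_nonneg]
  filter_upwards [ae_nonneg_prod hc hν] with p hp
  exact ⟨le_max_left _ _, add_nonneg hp.1.2 (mul_nonneg hlam.le hp.2)⟩

/-- The two visits differ only by exchanging the queues, so the second equation needs no new
computation. -/
lemma afterSecond_eq_map_swap (hc : 0 < c) [IsProbabilityMeasure ν] :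
    afterSecond c lam mu ν = (afterFirst c lam mu (ν.map Prod.swap)).map Prod.swap := by
  have := isProbabilityMeasure_expMeasure hc
  have h : (ν.map Prod.swap).prod (expMeasure c) =
      (ν.prod (expMeasure c)).map (Prod.map Prod.swap id) := by
    rw [← Measure.map_prod_map _ _ measurable_swap measurable_id, Measure.map_id]
  rw [afterFirst, h, Measure.map_map measurable_swap (measurable_serveFirst lam mu),
    Measure.map_map (by exact measurable_swap.comp (measurable_serveFirst lam mu))
      (measurable_swap.prodMap measurable_id)]
  rfl

lemma jointLaplace_map_swap (s₁ s₂ : ℂ) :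
    jointLaplace (ν.map Prod.swap) s₁ s₂ = jointLaplace ν s₂ s₁ := by
  rw [jointLaplace, integral_map measurable_swap.aemeasurable (by fun_prop), jointLaplace]
  simp only [Prod.fst_swap, Prod.snd_swap, add_comm]

lemma norm_exp_neg_le_one {s₁ s₂ : ℂ} (h₁ : 0 ≤ s₁.re) (h₂ : 0 ≤ s₂.re) {x y : ℝ} (hx : 0 ≤ x)
    (hy : 0 ≤ y) : ‖Complex.exp (-(s₁ * x + s₂ * y))‖ ≤ 1 := by
  rw [Complex.norm_exp]
  simp only [Complex.neg_re, Complex.add_re, Complex.mul_re, Complex.ofReal_re, Complex.ofReal_im,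
    mul_zero, sub_zero, Real.exp_le_one_iff, Left.neg_nonpos_iff]
  positivity

lemma integrable_exp_neg [IsFiniteMeasure ν] (hν : ∀ᵐ v ∂ν, 0 ≤ v.1 ∧ 0 ≤ v.2) {s₁ s₂ : ℂ}
    (h₁ : 0 ≤ s₁.re) (h₂ : 0 ≤ s₂.re) :
    Integrable (fun v : ℝ × ℝ => Complex.exp (-(s₁ * v.1 + s₂ * v.2))) ν := by
  refine Integrable.of_bound (C := 1) (by fun_prop) ?_
  filter_upwards [hν] with v hv using norm_exp_neg_le_one h₁ h₂ hv.1 hv.2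

/-- The integral is split at the time when queue 1 empties. Both sides carry the coefficient as a
factor instead of dividing by it, so that the zeros of the coefficient are included. -/
lemma integral_exp_serveFirst (hc : 0 < c) (hlam : 0 < lam) (hmu : lam < mu) {v : ℝ × ℝ}
    (hv : 0 ≤ v.1) {s₁ s₂ : ℂ} (h₂ : 0 ≤ s₂.re) :
    (c + lam * s₂ - (mu - lam) * s₁) *
      ∫ t, Complex.exp (-(s₁ * (serveFirst lam mu v t).1 + s₂ * (serveFirst lam mu v t).2))
        ∂expMeasure c =
    c * Complex.exp (-(s₁ * v.1 + s₂ * v.2)) - (mu - lam) * s₁ * (c / (c + lam * s₂) *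
      Complex.exp (-((c + lam * s₂) / (mu - lam) * v.1 + s₂ * v.2))) := by
  obtain ⟨x, y⟩ := v
  have hk : 0 < mu - lam := sub_pos.2 hmu
  have hkC : (mu : ℂ) - lam ≠ 0 := by exact_mod_cast hk.ne'
  have hbre : 0 < ((c : ℂ) + lam * s₂).re := by
    simp only [Complex.add_re, Complex.ofReal_re, Complex.mul_re, Complex.ofReal_im, zero_mul,
      sub_zero]
    positivity
  have hb : (c : ℂ) + lam * s₂ ≠ 0 := fun h => by simp [h] at hbre
  -- The emptying time: before `τ` the first workload decreases linearly, afterwards it is `0`.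
  set τ := x / (mu - lam) with hτ
  have hτ0 : 0 ≤ τ := div_nonneg hv hk.le
  have hxτ : (x : ℂ) = (mu - lam) * τ := by
    rw [hτ]; push_cast; field_simp
  rw [integral_expMeasure hc]
  set g : ℝ → ℂ := fun t => (c * Real.exp (-(c * t))) •
    Complex.exp (-(s₁ * (serveFirst lam mu (x, y) t).1 + s₂ * (serveFirst lam mu (x, y) t).2))
  set X : ℂ := c + lam * s₂ - (mu - lam) * s₁ with hX
  have hg1 : ∀ t ∈ Ioc 0 τ, g t =
      c * Complex.exp (-(s₁ * x + s₂ * y)) * Complex.exp (-X * t) := fun t ht => by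
    have : 0 ≤ x + (lam - mu) * t := by
      have := (le_div_iff₀ hk).1 ht.2; linarith
    simp only [g, serveFirst, max_eq_right this, Complex.real_smul]
    push_cast
    rw [mul_assoc, mul_assoc, ← Complex.exp_add, ← Complex.exp_add]
    congr 2; rw [hX]; ring
  have hg2 : ∀ t ∈ Ioi τ, g t =
      c * Complex.exp (-(s₂ * y)) * Complex.exp (-(c + lam * s₂) * t) := fun t ht => by
    have : x + (lam - mu) * t ≤ 0 := by
      have := (div_lt_iff₀ hk).1 ht; linarith
    simp only [g, serveFirst, max_eq_left this, Complex.real_smul]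
    push_cast
    rw [mul_assoc, mul_assoc, ← Complex.exp_add, ← Complex.exp_add]
    congr 2; ring
  have hre : (-((c : ℂ) + lam * s₂)).re < 0 := by rw [Complex.neg_re]; linarith
  have hint1 : IntegrableOn g (Ioc 0 τ) :=
    (Continuous.integrableOn_Ioc (by fun_prop)).congr_fun (fun t ht => (hg1 t ht).symm)
      measurableSet_Ioc
  have hint2 : IntegrableOn g (Ioi τ) :=
    IntegrableOn.congr_fun ((integrableOn_exp_mul_complex_Ioi hre τ).const_mul _)
      (fun t ht => (hg2 t ht).symm) measurableSet_Ioi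
  have hI1 : X * ∫ t in Ioc 0 τ, Complex.exp (-X * t) = 1 - Complex.exp (-X * τ) := by
    rw [← intervalIntegral.integral_of_le hτ0]
    by_cases h0 : X = 0
    · simp [h0]
    · rw [integral_exp_mul_complex (neg_ne_zero.2 h0)]
      field_simp
      simp
  rw [← Ioc_union_Ioi_eq_Ioi hτ0, setIntegral_union (Ioc_disjoint_Ioi le_rfl) measurableSet_Ioi
    hint1 hint2, setIntegral_congr_fun measurableSet_Ioc hg1,
    setIntegral_congr_fun measurableSet_Ioi hg2, integral_const_mul, integral_const_mul,
    integral_exp_mul_complex_Ioi hre, mul_add, mul_left_comm X, hI1]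
  have e1 : Complex.exp (-(s₁ * x + s₂ * y)) * Complex.exp (-X * τ) =
      Complex.exp (-(s₂ * y)) * Complex.exp (-(c + lam * s₂) * τ) := by
    rw [← Complex.exp_add, ← Complex.exp_add, hxτ]
    congr 1; rw [hX]; ring
  have e2 : Complex.exp (-((c + lam * s₂) / (mu - lam) * x + s₂ * y)) =
      Complex.exp (-(s₂ * y)) * Complex.exp (-(c + lam * s₂) * τ) := by
    rw [← Complex.exp_add, hxτ]
    congr 1; field_simp; ring
  rw [e2, mul_sub, mul_one, mul_assoc, e1]
  have hXb : X = (c + lam * s₂) - (mu - lam) * s₁ := rfl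
  rw [hXb]
  generalize Complex.exp (-(↑c + ↑lam * s₂) * ↑τ) = e
  generalize (c : ℂ) + lam * s₂ = b at hb ⊢
  field_simp
  ring

/-- The transform `E[exp (-s V₂); V₁ = 0]` at the end of a visit to queue 1. -/
def emptyLaplace (c lam mu : ℝ) (ν : Measure (ℝ × ℝ)) (s : ℂ) : ℂ :=
  c / (c + lam * s) * jointLaplace ν ((c + lam * s) / (mu - lam)) s

/-- The pointwise identity integrated over the starting workloads. Putting `s₁` at the zero of the
coefficient recovers the formula that defines `emptyLaplace`. -/
theorem jointLaplace_afterFirst (hc : 0 < c) (hlam : 0 < lam) (hmu : lam < mu)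
    [IsProbabilityMeasure ν] (hν : ∀ᵐ v ∂ν, 0 ≤ v.1 ∧ 0 ≤ v.2) {s₁ s₂ : ℂ} (h₁ : 0 ≤ s₁.re)
    (h₂ : 0 ≤ s₂.re) :
    (c + lam * s₂ - (mu - lam) * s₁) * jointLaplace (afterFirst c lam mu ν) s₁ s₂ =
      c * jointLaplace ν s₁ s₂ - (mu - lam) * s₁ * emptyLaplace c lam mu ν s₂ := by
  have := isProbabilityMeasure_expMeasure hc
  have hm := measurable_serveFirst lam mu
  have hre : 0 ≤ (((c : ℂ) + lam * s₂) / (mu - lam)).re := by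
    rw [← Complex.ofReal_sub, Complex.div_ofReal_re]
    refine div_nonneg ?_ (sub_pos.2 hmu).le
    simp only [Complex.add_re, Complex.ofReal_re, Complex.mul_re, Complex.ofReal_im, zero_mul,
      sub_zero]
    positivity
  rw [jointLaplace, afterFirst, integral_map hm.aemeasurable (by fun_prop), integral_prod _ ?_,
    ← integral_const_mul, emptyLaplace, jointLaplace, jointLaplace, ← integral_const_mul,
    ← integral_const_mul, ← integral_const_mul, ← integral_sub]
  · refine integral_congr_ae ?_
    filter_upwards [hν] with v hv
    exact integral_exp_serveFirst hc hlam hmu hv.1 h₂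
  · exact (integrable_exp_neg hν h₁ h₂).const_mul _
  · exact ((integrable_exp_neg hν hre h₂).const_mul _).const_mul _
  · refine Integrable.of_bound (C := 1) (by fun_prop) ?_
    filter_upwards [ae_nonneg_prod hc hν] with p hp
    exact norm_exp_neg_le_one h₁ h₂ (le_max_left _ _)
      (add_nonneg hp.1.2 (mul_nonneg hlam.le hp.2))

theorem jointLaplace_afterSecond (hc : 0 < c) (hlam : 0 < lam) (hmu : lam < mu)
    [IsProbabilityMeasure ν] (hν : ∀ᵐ v ∂ν, 0 ≤ v.1 ∧ 0 ≤ v.2) {s₁ s₂ : ℂ} (h₁ : 0 ≤ s₁.re)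
    (h₂ : 0 ≤ s₂.re) :
    (c + lam * s₁ - (mu - lam) * s₂) * jointLaplace (afterSecond c lam mu ν) s₁ s₂ =
      c * jointLaplace ν s₁ s₂ - (mu - lam) * s₂ * emptyLaplace c lam mu (ν.map Prod.swap) s₁ := by
  have := Measure.isProbabilityMeasure_map (μ := ν) measurable_swap.aemeasurable
  have hν' : ∀ᵐ v ∂ν.map Prod.swap, 0 ≤ v.1 ∧ 0 ≤ v.2 := by
    rw [ae_map_iff measurable_swap.aemeasurable
      measurableSet_nonneg]
    filter_upwards [hν] with v hv using ⟨hv.2, hv.1⟩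
  have h := jointLaplace_afterFirst hc hlam hmu hν' h₂ h₁
  rw [jointLaplace_map_swap] at h
  rw [afterSecond_eq_map_swap hc, jointLaplace_map_swap, h]

theorem IsCycleStationary.afterSecond_afterFirst (h : IsCycleStationary c lam mu ν) (hc : 0 < c) :
    afterSecond c lam mu (afterFirst c lam mu ν) = ν := by
  have := isProbabilityMeasure_expMeasure hc
  have := h.prob
  conv_rhs => rw [← h.invariant]
  -- At time `T₁ + T₂` the definition takes the branch of queue 1 exactly when `T₂ ≤ 0`, a null
  -- event.
  have h1 : ∀ᵐ ω : Cycle ∂cycleLaw c ν, workloadAt lam mu ω (ω.2.1 + ω.2.2) =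
      serveSecond lam mu (serveFirst lam mu ω.1 ω.2.1) ω.2.2 := by
    have h0 : ∀ᵐ x ∂expMeasure c, 0 < x := by
      have h0 : ∀ᵐ x ∂expMeasure c, x ≠ 0 :=
        (withDensity_absolutelyContinuous _ _).ae_le (show ∀ᵐ x : ℝ, x ≠ 0 by simp [ae_iff])
      filter_upwards [h0, ae_nonneg_expMeasure c] with x hx hx' using lt_of_le_of_ne hx' hx.symm
    have h2 : ∀ᵐ ω : Cycle ∂cycleLaw c ν, 0 < ω.2.2 :=
      Measure.quasiMeasurePreserving_snd.ae (Measure.quasiMeasurePreserving_snd.ae h0)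
    filter_upwards [h2] with ω hω
    rw [workloadAt, if_neg (by linarith), add_sub_cancel_left]
  rw [Measure.map_congr h1, cycleLaw, ← Measure.prodAssoc_prod, afterSecond, afterFirst]
  have h3 : (Measure.map (fun p : (ℝ × ℝ) × ℝ => serveFirst lam mu p.1 p.2)
      (ν.prod (expMeasure c))).prod (expMeasure c) =
      ((ν.prod (expMeasure c)).prod (expMeasure c)).map
        (Prod.map (fun p : (ℝ × ℝ) × ℝ => serveFirst lam mu p.1 p.2) id) := by
    rw [← Measure.map_prod_map _ _ (measurable_serveFirst lam mu) measurable_id, Measure.map_id]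
  have hm1 := measurable_serveFirst lam mu
  have hm2 := measurable_serveSecond lam mu
  rw [h3, Measure.map_map hm2 (hm1.prodMap measurable_id), Measure.map_map ?_ (by fun_prop)]
  · rfl
  · unfold serveSecond serveFirst; fun_prop

/-- By Tonelli `E ∫₀ᵀ g = ∫ g(t) P(T ≥ t) dt`, and `c P(T ≥ t)` is the exponential density itself.
Hence the time average over an exponential visit is the mean of the value at its end. -/
lemma lintegral_expMeasure_lintegral_Icc (hc : 0 < c) {g : ℝ → ENNReal} (hg : Measurable g) :
    ENNReal.ofReal c * ∫⁻ T, (∫⁻ t in Icc 0 T, g t) ∂expMeasure c = ∫⁻ t, g t ∂expMeasure c := by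
  have := isProbabilityMeasure_expMeasure hc
  have h1 : ∀ T, ∫⁻ t in Icc 0 T, g t = ∫⁻ t in Ici 0, (Iic T).indicator g t := fun T => by
    rw [lintegral_indicator measurableSet_Iic, Measure.restrict_restrict measurableSet_Iic,
      inter_comm, Ici_inter_Iic]
  have h2 : ∀ t T : ℝ, (Iic T).indicator g t = g t * (Ici t).indicator 1 T := fun t T => by
    by_cases h : t ≤ T
    · simp [indicator, h]
    · simp [indicator, h]
  simp_rw [h1, h2]
  rw [lintegral_lintegral_swap]
  swap
  · refine ((hg.comp measurable_snd).mul ?_).aemeasurable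
    exact (measurable_const (a := (1 : ENNReal))).indicator
      (s := {p : ℝ × ℝ | p.2 ≤ p.1}) (measurableSet_le measurable_snd measurable_fst)
  have h3 : ∀ t ∈ Ici (0 : ℝ), ∫⁻ T, g t * (Ici t).indicator 1 T ∂expMeasure c =
      g t * ENNReal.ofReal (Real.exp (-(c * t))) := fun t ht => by
    rw [lintegral_const_mul _ (measurable_one.indicator measurableSet_Ici),
      lintegral_indicator_one measurableSet_Ici, ← expMeasure_Ioi hc ht, ofReal_measureReal]
    congr 1
    have : expMeasure c {t} = 0 :=
      (withDensity_absolutelyContinuous volume (gammaPDF 1 c)) (by simp)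
    exact measure_congr (Ioi_ae_eq_Ici' this).symm
  rw [setLIntegral_congr_fun measurableSet_Ici h3, ← lintegral_const_mul' _ _ ENNReal.ofReal_ne_top,
    expMeasure, gammaMeasure, lintegral_withDensity_eq_lintegral_mul _
      (by exact (measurable_gammaPDFReal 1 c).ennreal_ofReal) hg, ← lintegral_indicator measurableSet_Ici]
  refine lintegral_congr fun t => ?_
  by_cases ht : 0 ≤ t
  · rw [indicator_of_mem (by exact ht), Pi.mul_apply, gammaPDF_of_nonneg ht, mul_left_comm, mul_comm (g t),
      ← ENNReal.ofReal_mul hc.le]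
    simp
  · rw [indicator_of_notMem (by exact ht), Pi.mul_apply, gammaPDF_of_neg (by linarith), zero_mul]

end FluidPolling

end

noncomputable section

/-! ### The workloads at an arbitrary epoch -/

namespace FluidPolling

variable {c lam mu : ℝ} {ν : Measure (ℝ × ℝ)}

lemma lintegral_afterFirst (hc : 0 < c) [IsProbabilityMeasure ν] {f : ℝ × ℝ → ENNReal}
    (hf : Measurable f) :
    ∫⁻ v, f v ∂afterFirst c lam mu ν = ∫⁻ v, ∫⁻ t, f (serveFirst lam mu v t) ∂expMeasure c ∂ν := by
  have := isProbabilityMeasure_expMeasure hc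
  have hm := measurable_serveFirst lam mu
  rw [afterFirst, lintegral_map hf hm, lintegral_prod _ (by exact (hf.comp hm).aemeasurable)]

lemma lintegral_afterSecond (hc : 0 < c) [IsProbabilityMeasure ν] {f : ℝ × ℝ → ENNReal}
    (hf : Measurable f) :
    ∫⁻ v, f v ∂afterSecond c lam mu ν =
      ∫⁻ v, ∫⁻ t, f (serveSecond lam mu v t) ∂expMeasure c ∂ν := by
  have := isProbabilityMeasure_expMeasure hc
  have hm := measurable_serveSecond lam mu
  rw [afterSecond, lintegral_map hf hm, lintegral_prod _ (by exact (hf.comp hm).aemeasurable)]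

lemma lintegral_workloadAt_cycle {T₁ T₂ : ℝ} (h₁ : 0 ≤ T₁) (h₂ : 0 ≤ T₂) (v : ℝ × ℝ)
    {f : ℝ × ℝ → ENNReal} :
    ∫⁻ t in Icc 0 (T₁ + T₂), f (workloadAt lam mu (v, T₁, T₂) t) =
      (∫⁻ t in Icc 0 T₁, f (serveFirst lam mu v t)) +
        ∫⁻ t in Icc 0 T₂, f (serveSecond lam mu (serveFirst lam mu v T₁) t) := by
  have hU : Icc 0 (T₁ + T₂) = Icc 0 T₁ ∪ Ioc T₁ (T₁ + T₂) :=
    (Icc_union_Ioc_eq_Icc h₁ (by linarith)).symm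
  have hD : Disjoint (Icc 0 T₁) (Ioc T₁ (T₁ + T₂)) :=
    Set.disjoint_left.2 fun t ht ht' => not_lt.2 ht.2 ht'.1
  rw [hU, lintegral_union measurableSet_Ioc hD]
  congr 1
  · refine setLIntegral_congr_fun measurableSet_Icc fun t ht => ?_
    simp only [workloadAt, if_pos ht.2]
  · rw [← setLIntegral_congr (Ioc_ae_eq_Icc (μ := volume)),
      ← (measurePreserving_sub_right volume T₁).setLIntegral_comp_preimage_emb
        (MeasurableEquiv.subRight T₁).measurableEmbedding _ (Ioc 0 T₂)]
    have : (fun t => t - T₁) ⁻¹' Ioc 0 T₂ = Ioc T₁ (T₁ + T₂) := by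
      ext t; simp [add_comm]
    rw [this]
    refine setLIntegral_congr_fun measurableSet_Ioc fun t ht => ?_
    simp only [workloadAt, if_neg (not_le.2 ht.1)]

/-- Each of the two visits takes half of the mean cycle time and contributes the law at its own end;
for the second visit that law is `ν` by stationarity. -/
theorem IsCycleStationary.arbitraryEpochLaw_eq (h : IsCycleStationary c lam mu ν) (hc : 0 < c) :
    arbitraryEpochLaw c lam mu ν = (2 : ENNReal)⁻¹ • afterFirst c lam mu ν + (2 : ENNReal)⁻¹ • ν := by
  have := isProbabilityMeasure_expMeasure hc
  have := h.prob
  have := isProbabilityMeasure_afterFirst (lam := lam) (mu := mu) (ν := ν) hc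
  have hmw := measurable_workloadAt lam mu
  have hm1 := measurable_serveFirst lam mu
  have hm2 := measurable_serveSecond lam mu
  refine Measure.ext_of_lintegral _ fun f hf => ?_
  have hS : MeasurableSet {p : Cycle × ℝ | 0 ≤ p.2 ∧ p.2 ≤ p.1.2.1 + p.1.2.2} :=
    show MeasurableSet ({p : Cycle × ℝ | 0 ≤ p.2} ∩ {p | p.2 ≤ p.1.2.1 + p.1.2.2}) from
    (measurableSet_le (by fun_prop) (by fun_prop)).inter
      (measurableSet_le (by fun_prop) (by fun_prop))
  have hcyc : cycleLaw c ν = ν.prod ((expMeasure c).prod (expMeasure c)) := rfl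
  have : IsProbabilityMeasure (cycleLaw c ν) := by rw [hcyc]; infer_instance
  rw [arbitraryEpochLaw, lintegral_smul_measure, lintegral_map hf hmw,
    ← lintegral_indicator hS, lintegral_prod _ (by exact ((hf.comp hmw).indicator hS).aemeasurable)]
  have hpos : ∀ᵐ ω : Cycle ∂cycleLaw c ν, 0 ≤ ω.2.1 ∧ 0 ≤ ω.2.2 :=
    (Measure.quasiMeasurePreserving_snd.ae (Measure.quasiMeasurePreserving_fst.ae
      (ae_nonneg_expMeasure c))).and (Measure.quasiMeasurePreserving_snd.ae
        (Measure.quasiMeasurePreserving_snd.ae (ae_nonneg_expMeasure c)))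
  have hT : MeasurableSet {p : ((ℝ × ℝ) × ℝ) × ℝ | 0 ≤ p.2 ∧ p.2 ≤ p.1.2} :=
    show MeasurableSet ({p : ((ℝ × ℝ) × ℝ) × ℝ | 0 ≤ p.2} ∩ {p | p.2 ≤ p.1.2}) from
    (measurableSet_le (by fun_prop) (by fun_prop)).inter
      (measurableSet_le (by fun_prop) (by fun_prop))
  have hg1 : Measurable fun q : (ℝ × ℝ) × ℝ => ∫⁻ t in Icc 0 q.2, f (serveFirst lam mu q.1 t) := by
    have : ∀ q : (ℝ × ℝ) × ℝ, ∫⁻ t in Icc 0 q.2, f (serveFirst lam mu q.1 t) =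
        ∫⁻ t, {p : ((ℝ × ℝ) × ℝ) × ℝ | 0 ≤ p.2 ∧ p.2 ≤ p.1.2}.indicator
          (fun p => f (serveFirst lam mu p.1.1 p.2)) (q, t) := fun q => by
      rw [← lintegral_indicator measurableSet_Icc]; rfl
    simp_rw [this]
    refine Measurable.lintegral_prod_right' ((hf.comp (hm1.comp
      (by fun_prop : Measurable fun p : ((ℝ × ℝ) × ℝ) × ℝ => (p.1.1, p.2)))).indicator ?_)
    exact hT
  have hg2 : Measurable fun q : (ℝ × ℝ) × ℝ => ∫⁻ t in Icc 0 q.2, f (serveSecond lam mu q.1 t) := by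
    have : ∀ q : (ℝ × ℝ) × ℝ, ∫⁻ t in Icc 0 q.2, f (serveSecond lam mu q.1 t) =
        ∫⁻ t, {p : ((ℝ × ℝ) × ℝ) × ℝ | 0 ≤ p.2 ∧ p.2 ≤ p.1.2}.indicator
          (fun p => f (serveSecond lam mu p.1.1 p.2)) (q, t) := fun q => by
      rw [← lintegral_indicator measurableSet_Icc]; rfl
    simp_rw [this]
    refine Measurable.lintegral_prod_right' ((hf.comp (hm2.comp
      (by fun_prop : Measurable fun p : ((ℝ × ℝ) × ℝ) × ℝ => (p.1.1, p.2)))).indicator ?_)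
    exact hT
  have hinner : ∫⁻ ω : Cycle, (∫⁻ t, {p : Cycle × ℝ | 0 ≤ p.2 ∧ p.2 ≤ p.1.2.1 + p.1.2.2}.indicator
        (fun p : Cycle × ℝ => f (workloadAt lam mu p.1 p.2)) (ω, t)) ∂cycleLaw c ν =
      ∫⁻ ω : Cycle, ((∫⁻ t in Icc 0 ω.2.1, f (serveFirst lam mu ω.1 t)) +
        ∫⁻ t in Icc 0 ω.2.2, f (serveSecond lam mu (serveFirst lam mu ω.1 ω.2.1) t))
          ∂cycleLaw c ν := by
    refine lintegral_congr_ae ?_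
    filter_upwards [hpos] with ω hω
    rw [← lintegral_workloadAt_cycle hω.1 hω.2, ← lintegral_indicator measurableSet_Icc]
    rfl
  have hG1 : Measurable fun ω : Cycle => ∫⁻ t in Icc 0 ω.2.1, f (serveFirst lam mu ω.1 t) :=
    hg1.comp (g := fun q : (ℝ × ℝ) × ℝ => ∫⁻ t in Icc 0 q.2, f (serveFirst lam mu q.1 t))
      (f := fun ω : Cycle => (ω.1, ω.2.1)) (by fun_prop)
  have hG2 : Measurable fun ω : Cycle =>
      ∫⁻ t in Icc 0 ω.2.2, f (serveSecond lam mu (serveFirst lam mu ω.1 ω.2.1) t) :=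
    hg2.comp (g := fun q : (ℝ × ℝ) × ℝ => ∫⁻ t in Icc 0 q.2, f (serveSecond lam mu q.1 t))
      (f := fun ω : Cycle => (serveFirst lam mu ω.1 ω.2.1, ω.2.2))
      ((hm1.comp (by fun_prop : Measurable fun ω : Cycle => (ω.1, ω.2.1))).prodMk (by fun_prop))
  have hfirst : ENNReal.ofReal c * ∫⁻ ω : Cycle, (∫⁻ t in Icc 0 ω.2.1, f (serveFirst lam mu ω.1 t))
      ∂cycleLaw c ν = ∫⁻ v, f v ∂afterFirst c lam mu ν := by
    rw [lintegral_afterFirst hc hf, hcyc, lintegral_prod _ (by exact hG1.aemeasurable),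
      ← lintegral_const_mul' _ _ ENNReal.ofReal_ne_top]
    refine lintegral_congr fun v => ?_
    rw [lintegral_prod _ (by exact (hG1.comp measurable_prodMk_left).aemeasurable)]
    simp only [lintegral_const, measure_univ, mul_one]
    exact lintegral_expMeasure_lintegral_Icc hc (hf.comp (hm1.comp measurable_prodMk_left))
  have hsecond : ENNReal.ofReal c * ∫⁻ ω : Cycle,
      (∫⁻ t in Icc 0 ω.2.2, f (serveSecond lam mu (serveFirst lam mu ω.1 ω.2.1) t))
        ∂cycleLaw c ν = ∫⁻ v, f v ∂ν := by
    conv_rhs => rw [← h.afterSecond_afterFirst hc]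
    rw [lintegral_afterSecond hc hf, lintegral_afterFirst hc
      (f := fun v => ∫⁻ t, f (serveSecond lam mu v t) ∂expMeasure c)
      (hf.comp hm2).lintegral_prod_right', hcyc,
      lintegral_prod _ (by exact hG2.aemeasurable), ← lintegral_const_mul' _ _ ENNReal.ofReal_ne_top]
    refine lintegral_congr fun v => ?_
    rw [lintegral_prod _ (by exact (hG2.comp measurable_prodMk_left).aemeasurable),
      ← lintegral_const_mul' _ _ ENNReal.ofReal_ne_top]
    refine lintegral_congr fun T => ?_
    exact lintegral_expMeasure_lintegral_Icc hc (hf.comp (hm2.comp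
      (measurable_prodMk_left (x := serveFirst lam mu v T))))
  have hhalf : ENNReal.ofReal (c / 2) = 2⁻¹ * ENNReal.ofReal c := by
    rw [div_eq_inv_mul, ENNReal.ofReal_mul (by norm_num), ENNReal.ofReal_inv_of_pos two_pos,
      ENNReal.ofReal_ofNat]
  rw [hinner, lintegral_add_left hG1, lintegral_add_measure, lintegral_smul_measure,
    lintegral_smul_measure, hhalf]
  simp only [smul_eq_mul]
  rw [mul_assoc, mul_add, hfirst, hsecond, mul_add]

end FluidPolling

end

noncomputable section

/-! ### Holomorphic functions real on the boundary, and the ellipse -/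

section ComplexAnalysis

/-- A holomorphic function on a bounded domain that is real on the boundary is constant. -/
theorem exists_real_eqOn_of_im_eq_zero_on_frontier {U : Set ℂ} {g : ℂ → ℂ}
    (hb : Bornology.IsBounded U) (ho : IsOpen U) (hc : IsPreconnected U) (hg : DiffContOnCl ℂ g U)
    (hreal : ∀ z ∈ frontier U, (g z).im = 0) : ∃ r : ℝ, ∀ z ∈ U, g z = r := by
  have hexp : ∀ a : ℂ, DiffContOnCl ℂ (fun z => Complex.exp (a * g z)) U := fun a =>
    ⟨(hg.differentiableOn.const_mul a).cexp, Complex.continuous_exp.comp_continuousOn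
      (continuousOn_const.mul hg.continuousOn)⟩
  -- Maximum modulus for `exp (± i g)`: both have modulus `1` on the boundary, so `Im g` is bounded
  -- by `0` from both sides inside.
  have him : ∀ z ∈ U, (g z).im = 0 := fun z hz => by
    have h1 := Complex.norm_le_of_forall_mem_frontier_norm_le hb (hexp Complex.I) (C := 1)
      (fun w hw => by simp [Complex.norm_exp, hreal w hw]) (subset_closure hz)
    have h2 := Complex.norm_le_of_forall_mem_frontier_norm_le hb (hexp (-Complex.I)) (C := 1)
      (fun w hw => by simp [Complex.norm_exp, hreal w hw]) (subset_closure hz)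
    simp only [Complex.norm_exp, Real.exp_le_one_iff, Complex.mul_re, Complex.I_re, Complex.I_im,
      Complex.neg_re, Complex.neg_im] at h1 h2
    linarith
  rcases U.eq_empty_or_nonempty with rfl | ⟨z₀, hz₀⟩
  · exact ⟨0, by simp⟩
  -- Open mapping theorem: the image lies in the real line, which has no interior in the plane.
  rcases (hg.differentiableOn.analyticOnNhd ho).is_constant_or_isOpen hc with ⟨w, hw⟩ | hopen
  · refine ⟨w.re, fun z hz => ?_⟩
    rw [hw z hz]
    apply Complex.ext
    · simp
    · rw [← hw z hz, him z hz]; simp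
  · exfalso
    have h1 := hopen U subset_rfl ho
    obtain ⟨ε, hε, hball⟩ := Metric.isOpen_iff.1 h1 (g z₀) (mem_image_of_mem g hz₀)
    have h2 : g z₀ + (ε / 2 : ℝ) * Complex.I ∈ Metric.ball (g z₀) ε := by
      rw [Metric.mem_ball, dist_eq_norm, add_sub_cancel_left, norm_mul, Complex.norm_I, mul_one,
        Complex.norm_real, Real.norm_of_nonneg (by positivity)]
      exact half_lt_self hε
    obtain ⟨z, hz, hzeq⟩ := hball h2
    have h3 := congrArg Complex.im hzeq
    rw [him z hz] at h3
    simp [him z₀ hz₀] at h3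
    linarith

/-- The interior of an ellipse through the origin, with centre `a` on the real axis. -/
def ellipse (a b : ℝ) : Set ℂ := {s | (s.re / a - 1) ^ 2 + (s.im / b) ^ 2 < 1}

variable {a b : ℝ}

lemma continuous_ellipse_form (a b : ℝ) :
    Continuous fun s : ℂ => (s.re / a - 1) ^ 2 + (s.im / b) ^ 2 := by fun_prop

lemma isOpen_ellipse (a b : ℝ) : IsOpen (ellipse a b) :=
  isOpen_lt (continuous_ellipse_form a b) continuous_const

lemma isPreconnected_ellipse (a b : ℝ) : IsPreconnected (ellipse a b) := by
  refine Convex.isPreconnected (convex_iff_forall_pos.2 fun x hx y hy α β hα hβ hαβ => ?_)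
  have key : ∀ u v : ℝ, (α * u + β * v) ^ 2 ≤ α * u ^ 2 + β * v ^ 2 := fun u v => by
    obtain rfl : β = 1 - α := by linarith
    nlinarith [mul_nonneg (mul_nonneg hα.le hβ.le) (sq_nonneg (u - v))]
  have h1 := key (x.re / a - 1) (y.re / a - 1)
  have h2 := key (x.im / b) (y.im / b)
  have hx' : (x.re / a - 1) ^ 2 + (x.im / b) ^ 2 < 1 := hx
  have hy' : (y.re / a - 1) ^ 2 + (y.im / b) ^ 2 < 1 := hy
  change ((α • x + β • y).re / a - 1) ^ 2 + ((α • x + β • y).im / b) ^ 2 < 1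
  have e1 : (α • x + β • y).re / a - 1 = α * (x.re / a - 1) + β * (y.re / a - 1) := by
    simp only [Complex.add_re, Complex.real_smul, Complex.re_ofReal_mul]
    linear_combination hαβ
  have e2 : (α • x + β • y).im / b = α * (x.im / b) + β * (y.im / b) := by
    simp only [Complex.add_im, Complex.real_smul, Complex.im_ofReal_mul]
    ring
  rw [e1, e2]
  nlinarith [mul_lt_mul_of_pos_left hx' hα, mul_lt_mul_of_pos_left hy' hβ]

lemma closure_ellipse_subset (a b : ℝ) :
    closure (ellipse a b) ⊆ {s | (s.re / a - 1) ^ 2 + (s.im / b) ^ 2 ≤ 1} :=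
  closure_lt_subset_le (continuous_ellipse_form a b) continuous_const

lemma frontier_ellipse_subset (a b : ℝ) :
    frontier (ellipse a b) ⊆ {s | (s.re / a - 1) ^ 2 + (s.im / b) ^ 2 = 1} :=
  frontier_lt_subset_eq (continuous_ellipse_form a b) continuous_const

lemma re_nonneg_of_mem_ellipse (ha : 0 < a) {s : ℂ}
    (hs : (s.re / a - 1) ^ 2 + (s.im / b) ^ 2 ≤ 1) : 0 ≤ s.re := by
  have h : 0 ≤ s.re / a := by nlinarith [sq_nonneg (s.im / b)]
  have := mul_nonneg h ha.le
  rwa [div_mul_cancel₀ _ ha.ne'] at this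

lemma re_pos_of_mem_ellipse (ha : 0 < a) {s : ℂ} (hs : s ∈ ellipse a b) : 0 < s.re := by
  have hs' : (s.re / a - 1) ^ 2 + (s.im / b) ^ 2 < 1 := hs
  have h : 0 < s.re / a := by nlinarith [sq_nonneg (s.im / b)]
  have := mul_pos h ha
  rwa [div_mul_cancel₀ _ ha.ne'] at this

lemma isBounded_ellipse (ha : 0 < a) (hb : 0 < b) : Bornology.IsBounded (ellipse a b) := by
  refine (Metric.isBounded_closedBall (x := (0 : ℂ)) (r := 2 * a + b)).subset fun s hs => ?_
  have hs' : (s.re / a - 1) ^ 2 + (s.im / b) ^ 2 < 1 := hs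
  have h1 := abs_le_of_sq_le_sq' (show (s.re / a - 1) ^ 2 ≤ 1 ^ 2 by nlinarith [sq_nonneg (s.im / b)])
    zero_le_one
  have h2 := abs_le_of_sq_le_sq' (show (s.im / b) ^ 2 ≤ 1 ^ 2 by
    nlinarith [sq_nonneg (s.re / a - 1)]) zero_le_one
  rw [mem_closedBall_zero_iff]
  refine (Complex.norm_le_abs_re_add_abs_im s).trans (add_le_add ?_ ?_)
  · rw [abs_of_pos (re_pos_of_mem_ellipse ha hs), ← div_le_iff₀ ha]; linarith
  · rw [abs_le]
    exact ⟨by have := (le_div_iff₀ hb).1 h2.1; linarith, by have := (div_le_iff₀ hb).1 h2.2; linarith⟩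

end ComplexAnalysis

/-! ### The infinite product over the rates and its functional equation -/

section RateProduct

variable {σ : ℕ → ℝ}

/-- The entire function `∏ (1 + s / σ_n)`. -/
def rateProduct (σ : ℕ → ℝ) (s : ℂ) : ℂ := ∏' n, (1 + s / σ n)

lemma hasProdLocallyUniformlyOn_rateProduct (hσ : ∀ n, 0 < σ n)
    (hs : Summable fun n => (σ n)⁻¹) :
    HasProdLocallyUniformlyOn (fun n (s : ℂ) => 1 + s / (σ n : ℂ)) (rateProduct σ) univ := by
  refine hasProdLocallyUniformlyOn_of_forall_compact isOpen_univ fun K _ hK => ?_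
  obtain ⟨R, hR⟩ := hK.isBounded.exists_norm_le
  refine (hs.mul_left R).hasProdUniformlyOn_nat_one_add (f := fun n (s : ℂ) => s / (σ n : ℂ)) hK ?_
    fun n => by fun_prop
  refine Eventually.of_forall fun n s hsK => ?_
  rw [norm_div, Complex.norm_real, Real.norm_of_nonneg (hσ n).le, div_eq_mul_inv]
  exact mul_le_mul_of_nonneg_right (hR s hsK) (inv_nonneg.2 (hσ n).le)

lemma differentiable_rateProduct (hσ : ∀ n, 0 < σ n) (hs : Summable fun n => (σ n)⁻¹) :
    Differentiable ℂ (rateProduct σ) := by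
  rw [← differentiableOn_univ]
  refine (hasProdLocallyUniformlyOn_rateProduct hσ hs).differentiableOn ?_ isOpen_univ
  exact Eventually.of_forall fun t => by fun_prop

lemma tendsto_prod_rateProduct (hσ : ∀ n, 0 < σ n) (hs : Summable fun n => (σ n)⁻¹) (s : ℂ) :
    Tendsto (fun N => ∏ n ∈ Finset.range N, (1 + s / σ n)) atTop (𝓝 (rateProduct σ s)) :=
  ((hasProdLocallyUniformlyOn_rateProduct hσ hs).hasProd (mem_univ s)).tendsto_prod_nat

lemma rateProduct_conj (hσ : ∀ n, 0 < σ n) (hs : Summable fun n => (σ n)⁻¹) (s : ℂ) :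
    rateProduct σ (starRingEnd ℂ s) = starRingEnd ℂ (rateProduct σ s) := by
  refine tendsto_nhds_unique (tendsto_prod_rateProduct hσ hs _) ?_
  refine ((Complex.continuous_conj.tendsto _).comp (tendsto_prod_rateProduct hσ hs s)).congr
    fun N => ?_
  simp [map_prod]

lemma rateProduct_zero : rateProduct σ 0 = 1 := by simp [rateProduct]

lemma one_le_rateProduct_re (hσ : ∀ n, 0 < σ n) (hs : Summable fun n => (σ n)⁻¹) {s : ℝ}
    (h0 : 0 ≤ s) : 1 ≤ (rateProduct σ s).re := by
  refine ge_of_tendsto' ((Complex.continuous_re.tendsto _).comp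
    (tendsto_prod_rateProduct hσ hs s)) fun N => ?_
  have : (∏ n ∈ Finset.range N, (1 + (s : ℂ) / σ n)) =
      ((∏ n ∈ Finset.range N, (1 + s / σ n) : ℝ) : ℂ) := by push_cast; rfl
  rw [Function.comp, this, Complex.ofReal_re]
  exact Finset.one_le_prod fun n _ => le_add_of_nonneg_right (div_nonneg h0 (hσ n).le)

/-- The functional equation of the product over the rates of the exponential summands. -/
theorem rateProduct_functional_equation {C q : ℝ} (hC : 0 < C) (hq : 0 < q) (hq1 : q < 1)
    {z w : ℂ} (hzw : z * w = 1) :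
    (1 - q * z) * rateProduct (summandRate C q)
        ((C * (1 + q) / (1 - q) ^ 2 : ℝ) * ((1 - w) * (1 - q * z))) =
      (1 - q * w) * rateProduct (summandRate C q)
        ((C * (1 + q) / (1 - q) ^ 2 : ℝ) * ((1 - z) * (1 - q * w))) := by
  have hσ := summandRate_pos hC hq
  have hs := summable_inv_summandRate hC hq hq1.le
  have hq1' : (0 : ℝ) < 1 - q := by linarith
  have hpow : ∀ n : ℕ, (0 : ℝ) < 1 - q ^ (n + 1) := fun n =>
    sub_pos.2 (pow_lt_one₀ hq.le hq1 (Nat.succ_ne_zero n))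
  -- In the parametrisation by `z w = 1` each factor of the product splits into a factor in `w` and
  -- one in `z`, with consecutive powers of `q`.
  have hfac : ∀ (n : ℕ) (z w : ℂ), z * w = 1 →
      1 + (C * (1 + q) / (1 - q) ^ 2 : ℝ) * ((1 - w) * (1 - q * z)) / (summandRate C q n : ℂ) =
        (1 - q ^ (n + 1) * w) * (1 - q ^ (n + 2) * z) /
          ((1 - q ^ (n + 1)) * (1 - q ^ (n + 2))) := fun n z w h => by
    have e : summandRate C q n =
        C * (1 + q) / (1 - q) ^ 2 * ((1 - q ^ (n + 1)) * (1 - q ^ (n + 2))) / q ^ (n + 1) := by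
      rw [summandRate, ← one_sub_mul_qnum, ← one_sub_mul_qnum]
      field_simp
    rw [e]
    have c1 : (1 : ℂ) - q ^ (n + 1) ≠ 0 := by exact_mod_cast (hpow n).ne'
    have c2 : (1 : ℂ) - q ^ (n + 2) ≠ 0 := by exact_mod_cast (hpow (n + 1)).ne'
    have c3 : (q : ℂ) ^ (n + 1) ≠ 0 := by exact_mod_cast (pow_pos hq _).ne'
    have c4 : (C : ℂ) * (1 + q) / (1 - q) ^ 2 ≠ 0 := by
      exact_mod_cast (show C * (1 + q) / (1 - q) ^ 2 ≠ 0 by positivity)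
    push_cast
    generalize (C : ℂ) * (1 + q) / (1 - q) ^ 2 = K at c4 ⊢
    rw [show (q : ℂ) ^ (n + 2) = q ^ (n + 1) * q by ring] at c2 ⊢
    generalize (q : ℂ) ^ (n + 1) = Q at c1 c2 c3 ⊢
    have hD := mul_ne_zero c1 c2
    generalize hDe : (1 - Q) * (1 - Q * (q : ℂ)) = D at hD ⊢
    field_simp
    rw [← hDe]
    linear_combination (Q * q - Q ^ 2 * q) * h
  -- With the two extra factors both sides become the symmetric product of `(1 - q ^ k w)(1 - q ^ k
  -- z)` over `1 ≤ k ≤ N + 1`, up to a common denominator. The factors with `q ^ (N + 1)` tend to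
  -- `1`.
  have hN : ∀ N : ℕ, (1 - q ^ (N + 1) * w) * (1 - q * z) * ∏ n ∈ Finset.range N,
        (1 + (C * (1 + q) / (1 - q) ^ 2 : ℝ) * ((1 - w) * (1 - q * z)) / (summandRate C q n : ℂ)) =
      (1 - q ^ (N + 1) * z) * (1 - q * w) * ∏ n ∈ Finset.range N,
        (1 + (C * (1 + q) / (1 - q) ^ 2 : ℝ) * ((1 - z) * (1 - q * w)) / (summandRate C q n : ℂ)) := by
    intro N
    induction N with
    | zero => simp; ring
    | succ N ih =>
      rw [Finset.prod_range_succ, Finset.prod_range_succ, hfac N z w hzw,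
        hfac N w z (by rw [mul_comm]; exact hzw)]
      linear_combination (1 - (q : ℂ) ^ (N + 2) * w) * (1 - q ^ (N + 2) * z) /
          ((1 - q ^ (N + 1)) * (1 - q ^ (N + 2))) * ih
  have hq0 : Tendsto (fun N : ℕ => (q : ℂ) ^ (N + 1)) atTop (𝓝 0) := by
    refine (tendsto_pow_atTop_nhds_zero_of_norm_lt_one ?_).comp (tendsto_add_atTop_nat 1)
    rwa [Complex.norm_real, Real.norm_of_nonneg hq.le]
  have hlim : ∀ x y u : ℂ, Tendsto (fun N : ℕ => (1 - (q : ℂ) ^ (N + 1) * x) * y *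
      ∏ n ∈ Finset.range N, (1 + u / (summandRate C q n : ℂ))) atTop
      (𝓝 (y * rateProduct (summandRate C q) u)) := fun x y u => by
    have := (((hq0.mul_const x).const_sub 1).mul_const y).mul (tendsto_prod_rateProduct hσ hs u)
    simpa using this
  refine tendsto_nhds_unique (hlim w _ _) ?_
  refine (hlim z _ _).congr fun N => ?_
  exact (hN N).symm

end RateProduct

end

noncomputable section

/-! ### The boundary relation on the ellipse -/

namespace FluidPolling

variable {c lam mu : ℝ} {ν : Measure (ℝ × ℝ)}

/-- The workloads weighted by `exp (-c V₁ / (mu - lam))`. -/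
def tiltedWorkload (c lam mu : ℝ) (ν : Measure (ℝ × ℝ)) : Measure (ℝ × ℝ) :=
  ν.withDensity fun v => ENNReal.ofReal (Real.exp (-(c / (mu - lam) * v.1)))

lemma isFiniteMeasure_tiltedWorkload (hc : 0 < c) (hmu : lam < mu) [IsProbabilityMeasure ν]
    (hν : ∀ᵐ v ∂ν, 0 ≤ v.1 ∧ 0 ≤ v.2) : IsFiniteMeasure (tiltedWorkload c lam mu ν) := by
  refine isFiniteMeasure_withDensity_ofReal (Integrable.hasFiniteIntegral ?_)
  refine Integrable.of_bound (C := 1) (by fun_prop) ?_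
  filter_upwards [hν] with v hv
  have := div_pos hc (sub_pos.2 hmu)
  simpa using mul_nonneg this.le hv.1

lemma ae_nonneg_tiltedWorkload (hlam : 0 < lam) (hmu : lam < mu)
    (hν : ∀ᵐ v ∂ν, 0 ≤ v.1 ∧ 0 ≤ v.2) :
    ∀ᵐ v ∂tiltedWorkload c lam mu ν, 0 ≤ lam / (mu - lam) * v.1 + v.2 := by
  refine (withDensity_absolutelyContinuous _ _).ae_le ?_
  filter_upwards [hν] with v hv
  exact add_nonneg (mul_nonneg (div_pos hlam (sub_pos.2 hmu)).le hv.1) hv.2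

/-- Absorbing `exp (-c V₁ / (mu - lam))` into the measure leaves the one-variable transform of a
nonnegative quantity, so that holomorphy and continuity in the half plane are available. -/
lemma emptyLaplace_eq_complexMGF (s : ℂ) :
    emptyLaplace c lam mu ν s = c / (c + lam * s) *
      complexMGF (fun v : ℝ × ℝ => lam / (mu - lam) * v.1 + v.2) (tiltedWorkload c lam mu ν) (-s) := by
  rw [emptyLaplace, jointLaplace, complexMGF, tiltedWorkload,
    integral_withDensity_eq_integral_toReal_smul (by fun_prop) (ae_of_all _ fun v => by simp)]
  congr 2; funext v
  rw [ENNReal.toReal_ofReal (Real.exp_pos _).le, Complex.real_smul, Complex.ofReal_exp,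
    ← Complex.exp_add]
  congr 1; push_cast; ring

lemma add_mul_ne_zero (hc : 0 < c) (hlam : 0 < lam) {s : ℂ} (hs : 0 ≤ s.re) :
    (c : ℂ) + lam * s ≠ 0 := by
  have h : 0 < ((c : ℂ) + lam * s).re := by
    simp only [Complex.add_re, Complex.ofReal_re, Complex.re_ofReal_mul]
    positivity
  intro h0
  simp [h0] at h

lemma continuousOn_emptyLaplace (hc : 0 < c) (hlam : 0 < lam) (hmu : lam < mu)
    [IsProbabilityMeasure ν] (hν : ∀ᵐ v ∂ν, 0 ≤ v.1 ∧ 0 ≤ v.2) :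
    ContinuousOn (emptyLaplace c lam mu ν) {s | 0 ≤ s.re} := by
  have := isFiniteMeasure_tiltedWorkload hc hmu hν
  rw [funext (emptyLaplace_eq_complexMGF (c := c) (lam := lam) (mu := mu) (ν := ν))]
  refine ContinuousOn.mul (ContinuousOn.div continuousOn_const (by fun_prop)
    fun s hs => add_mul_ne_zero hc hlam hs) ?_
  exact (continuousOn_complexMGF_of_nonneg (by fun_prop)
    (ae_nonneg_tiltedWorkload hlam hmu hν)).comp continuousOn_neg fun s hs => by simpa using hs

lemma differentiableOn_emptyLaplace (hc : 0 < c) (hlam : 0 < lam) (hmu : lam < mu)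
    [IsProbabilityMeasure ν] (hν : ∀ᵐ v ∂ν, 0 ≤ v.1 ∧ 0 ≤ v.2) :
    DifferentiableOn ℂ (emptyLaplace c lam mu ν) {s | 0 < s.re} := by
  have := isFiniteMeasure_tiltedWorkload hc hmu hν
  rw [funext (emptyLaplace_eq_complexMGF (c := c) (lam := lam) (mu := mu) (ν := ν))]
  refine DifferentiableOn.mul (DifferentiableOn.div (differentiableOn_const _) (by fun_prop)
    fun s hs => add_mul_ne_zero hc hlam (le_of_lt hs)) ?_
  exact (differentiableOn_complexMGF_of_nonneg (by fun_prop)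
    (ae_nonneg_tiltedWorkload hlam hmu hν)).comp differentiableOn_id.neg fun s hs => by
      simpa using hs

lemma jointLaplace_conj (s₁ s₂ : ℂ) : jointLaplace ν (starRingEnd ℂ s₁) (starRingEnd ℂ s₂) =
    starRingEnd ℂ (jointLaplace ν s₁ s₂) := by
  rw [jointLaplace, jointLaplace, ← integral_conj]
  congr 1; funext v
  rw [← Complex.exp_conj]
  simp

lemma emptyLaplace_conj (s : ℂ) : emptyLaplace c lam mu ν (starRingEnd ℂ s) =
    starRingEnd ℂ (emptyLaplace c lam mu ν s) := by
  rw [emptyLaplace, emptyLaplace, map_mul, ← jointLaplace_conj]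
  simp

lemma jointLaplace_diag_eq_mgf (s : ℝ) :
    jointLaplace ν s s = mgf (fun v : ℝ × ℝ => v.1 + v.2) ν (-s) := by
  rw [jointLaplace, mgf, ← integral_complex_ofReal]
  congr 1; funext v
  push_cast
  congr 1; ring

lemma tendsto_mgf_total [IsProbabilityMeasure ν] (hν : ∀ᵐ v ∂ν, 0 ≤ v.1 ∧ 0 ≤ v.2) :
    Tendsto (fun s : ℝ => mgf (fun v : ℝ × ℝ => v.1 + v.2) ν (-s)) (𝓝[>] 0) (𝓝 1) := by
  have h0 : mgf (fun v : ℝ × ℝ => v.1 + v.2) ν 0 = 1 := by simp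
  rw [← h0]
  unfold mgf
  refine tendsto_integral_filter_of_dominated_convergence (fun _ => 1)
    (Eventually.of_forall fun s => by fun_prop) ?_ (integrable_const _)
    (ae_of_all _ fun v => ?_)
  · filter_upwards [self_mem_nhdsWithin] with s hs
    filter_upwards [hν] with v hv
    have hs' : (0 : ℝ) < s := hs
    rw [Real.norm_eq_abs, Real.abs_exp, Real.exp_le_one_iff]
    nlinarith [hv.1, hv.2]
  · have : Continuous fun s : ℝ => Real.exp (-s * (v.1 + v.2)) := by fun_prop
    have h := this.tendsto 0
    simp only [neg_zero] at h
    exact h.mono_left nhdsWithin_le_nhds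

/-- The boundary value problem: on the ellipse, the transforms at the two ends of visits are
conjugate after multiplication by the product over the rates. -/
lemma conj_mul_eq_on_ellipse {C q δ : ℝ} (hC : 0 < C) (hq : 0 < q) (hq1 : q < 1) (hc : 0 < c)
    (hlam : 0 < lam) (hδ : 0 < δ) (hmu : mu = 2 * lam + δ)
    (hCq : C * (1 + q) / (1 - q) ^ 2 * (1 + q) = c / δ)
    (hCq' : C * (1 + q) / (1 - q) ^ 2 * (1 - q) = c / mu)
    [IsProbabilityMeasure ν] (hν : ∀ᵐ v ∂ν, 0 ≤ v.1 ∧ 0 ≤ v.2)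
    (hfix : afterSecond c lam mu (afterFirst c lam mu ν) = ν) {s : ℂ} (hs0 : s ≠ 0)
    (hs : (s.re / (c / δ) - 1) ^ 2 + (s.im / (c / mu)) ^ 2 = 1) :
    starRingEnd ℂ (emptyLaplace c lam mu ((afterFirst c lam mu ν).map Prod.swap) s *
      rateProduct (summandRate C q) s) =
    emptyLaplace c lam mu ν s * rateProduct (summandRate C q) s := by
  have hmu0 : 0 < mu := by linarith
  have hlm : lam < mu := by linarith
  have hre : 0 ≤ s.re := re_nonneg_of_mem_ellipse (div_pos hc hδ) hs.le
  have hre' : 0 ≤ (starRingEnd ℂ s).re := by simpa using hre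
  have := isProbabilityMeasure_afterFirst (lam := lam) (mu := mu) (ν := ν) hc
  have hφ := ae_nonneg_afterFirst (mu := mu) hc hlam hν
  have e1 := jointLaplace_afterFirst hc hlam hlm hν hre' hre
  have e2 := jointLaplace_afterSecond hc hlam hlm hφ hre' hre
  rw [hfix, emptyLaplace_conj] at e2
  set F := jointLaplace ν (starRingEnd ℂ s) s
  set G := jointLaplace (afterFirst c lam mu ν) (starRingEnd ℂ s) s
  set g := emptyLaplace c lam mu ν s
  set f := emptyLaplace c lam mu ((afterFirst c lam mu ν).map Prod.swap) s
  -- `z = x + i y` has modulus `1` exactly on the ellipse, and the coefficients of the two equations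
  -- at `(conj s, s)` are `c z` and `c w`.
  set x := 1 - s.re / (c / δ) with hx
  set y := s.im / (c / mu) with hy
  set z : ℂ := ⟨x, y⟩ with hz
  set w : ℂ := starRingEnd ℂ z with hw
  have hxy : x ^ 2 + y ^ 2 = 1 := by rw [← hs]; ring
  have hzw : z * w = 1 := by
    rw [hw, Complex.mul_conj, Complex.normSq_apply, hz]
    norm_cast
    linarith
  have hsre : s.re = c / δ * (1 - x) := by
    rw [hx, sub_sub_cancel, mul_div_cancel₀ _ (by positivity)]
  have hsim : s.im = c / mu * y := by
    rw [hy, mul_div_cancel₀ _ (by positivity)]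
  have hsr : s.re * δ = c * (1 - x) := by rw [hsre]; field_simp
  have hsi : s.im * mu = c * y := by rw [hsim]; field_simp
  have hX : (c : ℂ) + lam * s - (mu - lam) * starRingEnd ℂ s = c * z := by
    apply Complex.ext
    · simp [hz]
      rw [hmu]; linear_combination -hsr
    · simp [hz]
      linear_combination hsi
  have hY : (c : ℂ) + lam * starRingEnd ℂ s - (mu - lam) * s = c * w := by
    have := congrArg (starRingEnd ℂ) hX
    simpa using this
  rw [hX] at e1
  rw [hY] at e2
  have hcC : (c : ℂ) ≠ 0 := by exact_mod_cast hc.ne'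
  have hkC : (mu : ℂ) - lam ≠ 0 := by exact_mod_cast (sub_pos.2 hlm).ne'
  -- As `z w = 1`, the determinant of the system in `F` and `G` is zero, and a linear combination
  -- eliminates both.
  have hrel : s * starRingEnd ℂ f + w * starRingEnd ℂ s * g = 0 := by
    have : (c : ℂ) * (mu - lam) * (s * starRingEnd ℂ f + w * starRingEnd ℂ s * g) = 0 := by
      linear_combination c * w * e1 + c * e2 - c ^ 2 * G * hzw
    simpa [hcC, hkC] using this
  -- The two relations between `C`, `q` and `c` say that `s = K (1 + q - w - q z)` has half axes `c
  -- / δ` and `c / mu`.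
  have hsz : s = (C * (1 + q) / (1 - q) ^ 2 : ℝ) * ((1 - w) * (1 - q * z)) := by
    have : s = (C * (1 + q) / (1 - q) ^ 2 : ℝ) * (1 + q - w - q * z) := by
      apply Complex.ext
      · rw [Complex.re_ofReal_mul, hsre, ← hCq]
        simp [hw, hz]; ring
      · rw [Complex.im_ofReal_mul, hsim, ← hCq']
        simp [hw, hz]; ring
    rw [this]; linear_combination (-q * (C * (1 + q) / (1 - q) ^ 2 : ℝ)) * hzw
  have hszc : starRingEnd ℂ s = (C * (1 + q) / (1 - q) ^ 2 : ℝ) * ((1 - z) * (1 - q * w)) := by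
    have := congrArg (starRingEnd ℂ) hsz
    rw [this]
    simp [hw]
  have hP := rateProduct_functional_equation hC hq hq1 hzw
  rw [← hsz, ← hszc, rateProduct_conj (summandRate_pos hC hq)
    (summable_inv_summandRate hC hq hq1.le)] at hP
  set P := rateProduct (summandRate C q) s
  -- The functional equation, written so that `P` obeys the relation that the quotient of `g` and
  -- `conj f` requires.
  have hrel2 : s * P = -w * starRingEnd ℂ s * starRingEnd ℂ P := by
    calc s * P = (C * (1 + q) / (1 - q) ^ 2 : ℝ) * (1 - w) * ((1 - q * z) * P) := by
          conv_lhs => rw [hsz]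
          ring
      _ = _ := by
          rw [hP, hszc]
          linear_combination (-(C * (1 + q) / (1 - q) ^ 2 : ℝ) * (1 - q * w) *
            starRingEnd ℂ P) * hzw
  have hw0 : w ≠ 0 := right_ne_zero_of_mul_eq_one hzw
  have hsc0 : starRingEnd ℂ s ≠ 0 := by simpa using hs0
  have hne : s * starRingEnd ℂ s * w ≠ 0 := by simp [hs0, hw0]
  rw [map_mul]
  refine mul_left_cancel₀ hne ?_
  linear_combination (w * starRingEnd ℂ s * starRingEnd ℂ P) * hrel - (w * starRingEnd ℂ s * g) * hrel2

end FluidPolling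

end

noncomputable section

/-! ### Solution of the boundary value problem -/

namespace FluidPolling

variable {c lam mu : ℝ} {ν : Measure (ℝ × ℝ)}

/-- Solution of the boundary value problem. -/
theorem mgf_total_mul_rateProduct {C q δ : ℝ} (hC : 0 < C) (hq : 0 < q) (hq1 : q < 1) (hc : 0 < c)
    (hlam : 0 < lam) (hδ : 0 < δ) (hmu : mu = 2 * lam + δ)
    (hCq : C * (1 + q) / (1 - q) ^ 2 * (1 + q) = c / δ)
    (hCq' : C * (1 + q) / (1 - q) ^ 2 * (1 - q) = c / mu)
    [IsProbabilityMeasure ν] (hν : ∀ᵐ v ∂ν, 0 ≤ v.1 ∧ 0 ≤ v.2)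
    (hfix : afterSecond c lam mu (afterFirst c lam mu ν) = ν) :
    ∀ s ∈ Ioo 0 (2 * (c / δ)),
      mgf (fun v : ℝ × ℝ => v.1 + v.2) ν (-s) * (rateProduct (summandRate C q) s).re = 1 ∧
      mgf (fun v : ℝ × ℝ => v.1 + v.2) (afterFirst c lam mu ν) (-s) =
        mgf (fun v : ℝ × ℝ => v.1 + v.2) ν (-s) := by
  have hmu0 : 0 < mu := by linarith
  have hlm : lam < mu := by linarith
  have ha : 0 < c / δ := div_pos hc hδ
  have hb : 0 < c / mu := div_pos hc hmu0
  have hσ := summandRate_pos hC hq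
  have hsum := summable_inv_summandRate hC hq hq1.le
  have := isProbabilityMeasure_afterFirst (lam := lam) (mu := mu) (ν := ν) hc
  have hφ := ae_nonneg_afterFirst (mu := mu) hc hlam hν
  have := Measure.isProbabilityMeasure_map (μ := afterFirst c lam mu ν) measurable_swap.aemeasurable
  have hφ' : ∀ᵐ v ∂(afterFirst c lam mu ν).map Prod.swap, 0 ≤ v.1 ∧ 0 ≤ v.2 := by
    rw [ae_map_iff measurable_swap.aemeasurable measurableSet_nonneg]
    filter_upwards [hφ] with v hv using ⟨hv.2, hv.1⟩
  set P := rateProduct (summandRate C q)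
  set f₁ : ℂ → ℂ := fun s => emptyLaplace c lam mu ν s * P s with hf₁
  set f₂ : ℂ → ℂ := fun s => emptyLaplace c lam mu ((afterFirst c lam mu ν).map Prod.swap) s * P s
    with hf₂
  have hPd : Differentiable ℂ P := differentiable_rateProduct hσ hsum
  have hc₁ : ContinuousOn f₁ {s | 0 ≤ s.re} :=
    (continuousOn_emptyLaplace hc hlam hlm hν).mul hPd.continuous.continuousOn
  have hc₂ : ContinuousOn f₂ {s | 0 ≤ s.re} :=
    (continuousOn_emptyLaplace hc hlam hlm hφ').mul hPd.continuous.continuousOn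
  have hd₁ : DifferentiableOn ℂ f₁ {s | 0 < s.re} :=
    (differentiableOn_emptyLaplace hc hlam hlm hν).mul hPd.differentiableOn
  have hd₂ : DifferentiableOn ℂ f₂ {s | 0 < s.re} :=
    (differentiableOn_emptyLaplace hc hlam hlm hφ').mul hPd.differentiableOn
  have hsubU : ellipse (c / δ) (c / mu) ⊆ {s | 0 < s.re} := fun s hs => re_pos_of_mem_ellipse ha hs
  have hsubC : closure (ellipse (c / δ) (c / mu)) ⊆ {s | 0 ≤ s.re} := fun s hs =>
    re_nonneg_of_mem_ellipse ha (closure_ellipse_subset _ _ hs)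
  have hD₁ : DiffContOnCl ℂ f₁ (ellipse (c / δ) (c / mu)) := ⟨hd₁.mono hsubU, hc₁.mono hsubC⟩
  have hD₂ : DiffContOnCl ℂ f₂ (ellipse (c / δ) (c / mu)) := ⟨hd₂.mono hsubU, hc₂.mono hsubC⟩
  have hbd0 : ∀ s : ℂ, s ≠ 0 → (s.re / (c / δ) - 1) ^ 2 + (s.im / (c / mu)) ^ 2 = 1 →
      starRingEnd ℂ (f₂ s) = f₁ s := fun s hs0 hs =>
    conj_mul_eq_on_ellipse hC hq hq1 hc hlam hδ hmu hCq hCq' hν hfix hs0 hs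
  -- The boundary relation was obtained after cancelling `s`; the origin, which lies on the ellipse,
  -- is reached by continuity along the ellipse.
  have hzero : starRingEnd ℂ (f₂ 0) = f₁ 0 := by
    set γ : ℝ → ℂ := fun θ => ⟨c / δ * (1 - Real.cos θ), c / mu * Real.sin θ⟩ with hγ
    have hγc : Continuous γ := by
      have : γ = fun θ => ((c / δ * (1 - Real.cos θ) : ℝ) : ℂ) +
          ((c / mu * Real.sin θ : ℝ) : ℂ) * Complex.I := by
        funext θ; exact Complex.mk_eq_add_mul_I _ _
      rw [this]; fun_prop
    have hγ0 : γ 0 = 0 := by simp [hγ, Complex.ext_iff]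
    have hγre : ∀ θ, 0 ≤ (γ θ).re := fun θ =>
      mul_nonneg ha.le (sub_nonneg.2 (Real.cos_le_one θ))
    have hlim : ∀ f : ℂ → ℂ, ContinuousOn f {s | 0 ≤ s.re} →
        Tendsto (fun θ => f (γ θ)) (𝓝[>] 0) (𝓝 (f 0)) := fun f hf => by
      have : Continuous fun θ => f (γ θ) := hf.comp_continuous hγc hγre
      have h := this.tendsto 0
      rw [hγ0] at h
      exact h.mono_left nhdsWithin_le_nhds
    refine tendsto_nhds_unique ((Complex.continuous_conj.tendsto _).comp (hlim f₂ hc₂)) ?_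
    refine (hlim f₁ hc₁).congr' ?_
    filter_upwards [Ioo_mem_nhdsGT Real.pi_pos] with θ hθ
    have hsin : 0 < Real.sin θ := Real.sin_pos_of_mem_Ioo hθ
    refine (hbd0 (γ θ) (fun h => ?_) ?_).symm
    · have := congrArg Complex.im h
      simp only [hγ, Complex.zero_im] at this
      exact (mul_pos hb hsin).ne' this
    · simp only [hγ]
      rw [mul_div_cancel_left₀ _ ha.ne', mul_div_cancel_left₀ _ hb.ne']
      have := Real.sin_sq_add_cos_sq θ
      linarith
  have hbd : ∀ s ∈ frontier (ellipse (c / δ) (c / mu)), starRingEnd ℂ (f₂ s) = f₁ s := fun s hs => by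
    rcases eq_or_ne s 0 with rfl | h0
    · exact hzero
    · exact hbd0 s h0 (frontier_ellipse_subset _ _ hs)
  -- `f₁ = conj f₂` on the boundary makes `f₁ + f₂` and `i (f₁ - f₂)` real there, so both are
  -- constant inside.
  obtain ⟨r₁, hr₁⟩ := exists_real_eqOn_of_im_eq_zero_on_frontier (isBounded_ellipse ha hb)
    (isOpen_ellipse _ _) (isPreconnected_ellipse _ _) (hD₁.add hD₂) (fun s hs => by
      rw [Pi.add_apply, ← hbd s hs]; simp)
  obtain ⟨r₂, hr₂⟩ := exists_real_eqOn_of_im_eq_zero_on_frontier (isBounded_ellipse ha hb)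
    (isOpen_ellipse _ _) (isPreconnected_ellipse _ _) ((hD₁.sub hD₂).const_smul Complex.I)
    (fun s hs => by
      rw [Pi.smul_apply, Pi.sub_apply, ← hbd s hs]; simp)
  have hmem : ∀ s ∈ Ioo 0 (2 * (c / δ)), (s : ℂ) ∈ ellipse (c / δ) (c / mu) := fun s hs => by
    change ((s : ℂ).re / (c / δ) - 1) ^ 2 + ((s : ℂ).im / (c / mu)) ^ 2 < 1
    have h1 : 0 < s / (c / δ) := div_pos hs.1 ha
    have h2 : s / (c / δ) < 2 := (div_lt_iff₀ ha).2 hs.2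
    simp only [Complex.ofReal_re, Complex.ofReal_im, zero_div]
    nlinarith
  have hkC : (mu : ℂ) - lam ≠ 0 := by exact_mod_cast (sub_pos.2 hlm).ne'
  have hmuC : (mu : ℂ) = 2 * lam + δ := by exact_mod_cast hmu
  have main : ∀ s ∈ Ioo 0 (2 * (c / δ)),
      ((mgf (fun v : ℝ × ℝ => v.1 + v.2) ν (-s) * (P s).re : ℝ) : ℂ) =
        (mu - lam) / (2 * δ) * r₁ ∧
      mgf (fun v : ℝ × ℝ => v.1 + v.2) (afterFirst c lam mu ν) (-s) =
        mgf (fun v : ℝ × ℝ => v.1 + v.2) ν (-s) := fun s hs => by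
    have hs0 : 0 ≤ (s : ℂ).re := by simpa using hs.1.le
    have hsC : (s : ℂ) ≠ 0 := by exact_mod_cast hs.1.ne'
    have hPre : P s = ((P s).re : ℂ) := by
      have := rateProduct_conj hσ hsum (s : ℂ)
      rw [Complex.conj_ofReal] at this
      exact (Complex.conj_eq_iff_re.1 this.symm).symm
    have hPpos : (P s).re ≠ 0 := by
      have := one_le_rateProduct_re hσ hsum hs.1.le
      exact (lt_of_lt_of_le one_pos this).ne'
    have him : ∀ ν' : Measure (ℝ × ℝ), (emptyLaplace c lam mu ν' s).im = 0 := fun ν' => by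
      have := emptyLaplace_conj (c := c) (lam := lam) (mu := mu) (ν := ν') (s : ℂ)
      rw [Complex.conj_ofReal] at this
      exact Complex.conj_eq_iff_im.1 this.symm
    have hPim : (P s).im = 0 := by rw [hPre]; simp
    have h1 := hr₁ s (hmem s hs)
    have h2 := hr₂ s (hmem s hs)
    rw [Pi.add_apply] at h1
    rw [Pi.smul_apply, Pi.sub_apply, smul_eq_mul] at h2
    -- On the real axis `f₁ - f₂` is real, while `i (f₁ - f₂)` equals a real constant; hence the
    -- difference vanishes.
    have h3 : f₁ s = f₂ s := by
      have him₁ : (f₁ s).im = 0 := by rw [hf₁, Complex.mul_im, hPim, him]; simp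
      have him₂ : (f₂ s).im = 0 := by rw [hf₂, Complex.mul_im, hPim, him]; simp
      have h4 := congrArg Complex.im h2
      simp only [Complex.mul_im, Complex.I_re, Complex.I_im, Complex.sub_re, Complex.ofReal_im] at h4
      apply Complex.ext
      · linarith
      · rw [him₁, him₂]
    have hg : emptyLaplace c lam mu ν s =
        emptyLaplace c lam mu ((afterFirst c lam mu ν).map Prod.swap) s := by
      refine mul_right_cancel₀ (b := P s) ?_ h3
      rw [hPre]; exact_mod_cast hPpos
    have e1 := jointLaplace_afterFirst hc hlam hlm hν hs0 hs0
    have e2 := jointLaplace_afterSecond hc hlam hlm hφ hs0 hs0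
    rw [hfix, ← hg] at e2
    have hsumne : (2 * c - δ * s : ℂ) ≠ 0 := by
      have : 2 * c - δ * s ≠ 0 := by
        have := (lt_div_iff₀ hδ).1 (show s < 2 * c / δ by rw [mul_div_assoc]; exact hs.2)
        linarith
      exact_mod_cast this
    -- With `f = g` the difference of the diagonal equations is `(2c - δ s)(G - F) = 0`; the ellipse
    -- meets the real axis exactly up to the zero `2c / δ`.
    have hFG : jointLaplace (afterFirst c lam mu ν) s s = jointLaplace ν s s := by
      refine mul_left_cancel₀ hsumne ?_
      rw [hmuC] at e1 e2
      linear_combination e1 - e2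
    have hδC : (δ : ℂ) ≠ 0 := by exact_mod_cast hδ.ne'
    have hF : (δ : ℂ) * jointLaplace ν s s = (mu - lam) * emptyLaplace c lam mu ν s := by
      refine mul_left_cancel₀ hsC ?_
      rw [hFG] at e1
      linear_combination -e1 - (s : ℂ) * jointLaplace ν s s * hmuC
    refine ⟨?_, ?_⟩
    · push_cast
      rw [← jointLaplace_diag_eq_mgf, ← hPre]
      have h5 : 2 * (emptyLaplace c lam mu ν s * P s) = r₁ := by
        rw [← h1, ← h3]; simp only [hf₁]; ring
      rw [← h5]
      field_simp
      linear_combination P s * hF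
    · rw [jointLaplace_diag_eq_mgf, jointLaplace_diag_eq_mgf] at hFG
      exact_mod_cast hFG
  -- The constant is found from `s ↓ 0`, where the transform tends to `1` and `P 0 = 1`.
  have hconst : ((mu : ℂ) - lam) / (2 * δ) * r₁ = 1 := by
    have hlim : Tendsto (fun s : ℝ =>
        ((mgf (fun v : ℝ × ℝ => v.1 + v.2) ν (-s) * (P s).re : ℝ) : ℂ)) (𝓝[>] 0)
        (𝓝 ((1 * (P 0).re : ℝ) : ℂ)) := by
      refine (Complex.continuous_ofReal.tendsto _).comp ((tendsto_mgf_total hν).mul ?_)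
      have : Continuous fun s : ℝ => (P s).re :=
        Complex.continuous_re.comp (hPd.continuous.comp Complex.continuous_ofReal)
      have h := this.tendsto 0
      rw [Complex.ofReal_zero] at h
      exact h.mono_left nhdsWithin_le_nhds
    have hP0 : P 0 = 1 := rateProduct_zero
    rw [hP0] at hlim
    have h2 : Tendsto (fun s : ℝ =>
        ((mgf (fun v : ℝ × ℝ => v.1 + v.2) ν (-s) * (P s).re : ℝ) : ℂ)) (𝓝[>] 0)
        (𝓝 (((mu : ℂ) - lam) / (2 * δ) * r₁)) := by
      refine tendsto_const_nhds.congr' ?_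
      filter_upwards [Ioo_mem_nhdsGT (show (0 : ℝ) < 2 * (c / δ) by positivity)] with s hs
      exact (main s hs).1.symm
    simpa using tendsto_nhds_unique h2 hlim
  intro s hs
  refine ⟨?_, (main s hs).2⟩
  have := (main s hs).1
  rw [hconst] at this
  exact_mod_cast this

end FluidPolling

end

noncomputable section

/-! ### The law of the scaled total workload and its limit -/

namespace FluidPolling

lemma summandRate_mul_left (C a q : ℝ) (n : ℕ) :
    summandRate (C * a) q n = a * summandRate C q n := by
  rw [summandRate, summandRate]; ring

/-- The unscaled total has rates `(1/2 - rho) r_n`; multiplying it by `1/2 - rho` restores `r_n`.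
Knowledge of the transform on a bounded interval is enough to identify the law. -/
lemma scaledTotalLaw_eq_gammaSeriesLaw {C q rho b : ℝ} (hC : 0 < C) (hq : 0 < q) (hq1 : q < 1)
    (hrho : rho < 1 / 2) (hb : 0 < b) {ν : Measure (ℝ × ℝ)} [IsProbabilityMeasure ν]
    (hν : ∀ᵐ v ∂ν, 0 ≤ v.1 ∧ 0 ≤ v.2)
    (h : ∀ s ∈ Ioo 0 b, mgf (fun v : ℝ × ℝ => v.1 + v.2) ν (-s) *
      (rateProduct (summandRate (C * (1 / 2 - rho)) q) s).re = 1) :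
    scaledTotalLaw rho ν = gammaSeriesLaw 1 (summandRate C q) := by
  have hk : 0 < 1 / 2 - rho := by linarith
  have hr := summandRate_pos hC hq
  have hσ := summandRate_pos (mul_pos hC hk) hq
  have hm : Measurable fun v : ℝ × ℝ => (1 / 2 - rho) * (v.1 + v.2) := by fun_prop
  have := Measure.isProbabilityMeasure_map (μ := ν) hm.aemeasurable
  rw [scaledTotalLaw]
  refine eq_gammaSeriesLaw_of_tendsto one_pos hr (summable_inv_summandRate hC hq hq1.le) ?_
    (neg_neg_of_pos (div_pos hb hk)) fun t ht => ?_
  · rw [ae_map_iff hm.aemeasurable measurableSet_Ici]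
    filter_upwards [hν] with v hv using mul_nonneg hk.le (add_nonneg hv.1 hv.2)
  · set s := -((1 / 2 - rho) * t) with hs
    have hsI : s ∈ Ioo 0 b := by
      refine ⟨by rw [hs]; nlinarith [ht.2], ?_⟩
      have := (lt_div_iff₀ hk).1 (neg_lt.1 ht.1)
      rw [hs]; linarith
    have hmgf : mgf id (Measure.map (fun v : ℝ × ℝ => (1 / 2 - rho) * (v.1 + v.2)) ν) t =
        mgf (fun v : ℝ × ℝ => v.1 + v.2) ν (-s) := by
      rw [mgf_id_map hm.aemeasurable, mgf, mgf, hs]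
      congr 1; funext v; ring_nf
    have h1 := h s hsI
    have hne : (rateProduct (summandRate (C * (1 / 2 - rho)) q) s).re ≠ 0 :=
      right_ne_zero_of_mul_eq_one h1
    rw [hmgf, eq_inv_of_mul_eq_one_left h1]
    refine (((Complex.continuous_re.tendsto _).comp (tendsto_prod_rateProduct hσ
      (summable_inv_summandRate (mul_pos hC hk) hq hq1.le) s)).inv₀ hne).congr fun N => ?_
    have e : (∏ n ∈ Finset.range N, (1 + (s : ℂ) / summandRate (C * (1 / 2 - rho)) q n)) =
        ((∏ n ∈ Finset.range N, (1 + s / summandRate (C * (1 / 2 - rho)) q n) : ℝ) : ℂ) := by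
      push_cast; rfl
    rw [Function.comp, e, Complex.ofReal_re, ← Finset.prod_inv_distrib]
    refine Finset.prod_congr rfl fun n _ => ?_
    have hrn := hr n
    rw [summandRate_mul_left, hs, Real.rpow_one, neg_div, mul_div_mul_left _ _ hk.ne',
      ← sub_eq_add_neg, one_sub_div hrn.ne', inv_div]

/-- With `δ = mu (1 - 2 rho)` the ratio `δ / mu` of the coefficients must be `(1 - q) / (1 + q)`,
which forces `q = rho / (1 - rho)`; the prefactor before scaling is then `(2c / mu)(1/2 - rho)`. -/
theorem IsStationaryWorkloadLaw.scaledTotalLaw_eq {c mu rho : ℝ} (hc : 0 < c) (hmu : 0 < mu)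
    (hrho : rho ∈ Ioo (0 : ℝ) (1 / 2)) {V : Measure (ℝ × ℝ)}
    (hV : IsStationaryWorkloadLaw c (rho * mu) mu V) :
    scaledTotalLaw rho V = gammaSeriesLaw 1 (summandRate (2 * c / mu) (rho / (1 - rho))) := by
  obtain ⟨h0, h1⟩ := hrho
  have hr1 : 0 < 1 - rho := by linarith
  have hr2 : 0 < 1 - 2 * rho := by linarith
  have hq : 0 < rho / (1 - rho) := div_pos h0 hr1
  have hq1 : rho / (1 - rho) < 1 := (div_lt_one hr1).2 (by linarith)
  have hC : 0 < 2 * c / mu := by positivity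
  have hlam : 0 < rho * mu := by positivity
  have hδ : 0 < mu * (1 - 2 * rho) := by positivity
  have hC' : 0 < 2 * c / mu * (1 / 2 - rho) := mul_pos hC (by linarith)
  have e1 : 1 + rho / (1 - rho) = 1 / (1 - rho) := by field_simp; ring
  have e2 : 1 - rho / (1 - rho) = (1 - 2 * rho) / (1 - rho) := by field_simp; ring
  have e3 : 1 / 2 - rho = (1 - 2 * rho) / 2 := by ring
  have key : ∀ ν, IsCycleStationary c (rho * mu) mu ν →
      scaledTotalLaw rho ν = gammaSeriesLaw 1 (summandRate (2 * c / mu) (rho / (1 - rho))) ∧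
      scaledTotalLaw rho (afterFirst c (rho * mu) mu ν) =
        gammaSeriesLaw 1 (summandRate (2 * c / mu) (rho / (1 - rho))) := fun ν h => by
    have := h.prob
    have := isProbabilityMeasure_afterFirst (lam := rho * mu) (mu := mu) (ν := ν) hc
    have hb : 0 < 2 * (c / (mu * (1 - 2 * rho))) := by positivity
    have hsol := mgf_total_mul_rateProduct hC' hq hq1 hc hlam hδ (by ring)
      (by rw [e1, e2, e3]; field_simp) (by rw [e1, e2, e3]; field_simp) h.nonneg
      (h.afterSecond_afterFirst hc)
    refine ⟨scaledTotalLaw_eq_gammaSeriesLaw hC hq hq1 h1 hb h.nonneg fun s hs => (hsol s hs).1,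
      scaledTotalLaw_eq_gammaSeriesLaw hC hq hq1 h1 hb (ae_nonneg_afterFirst hc hlam h.nonneg)
        fun s hs => ?_⟩
    rw [(hsol s hs).2]
    exact (hsol s hs).1
  cases hV with
  | cycleStart _ h => exact (key V h).1
  | arbitraryEpoch ν h =>
    have hm : Measurable fun v : ℝ × ℝ => (1 / 2 - rho) * (v.1 + v.2) := by fun_prop
    obtain ⟨k1, k2⟩ := key ν h
    rw [scaledTotalLaw] at k1 k2
    rw [h.arbitraryEpochLaw_eq hc, scaledTotalLaw, Measure.map_add _ _ hm, Measure.map_smul,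
      Measure.map_smul, k1, k2, ← add_smul, ENNReal.inv_two_add_inv_two, one_smul]

/-- At `q = 1` the rates are `(c / mu) * 4 (n + 1)(n + 2)`, and `4 (n + 1)(n + 2) = (2n + 3)² - 1`.
-/
lemma limitRate_succ (c mu : ℝ) (n : ℕ) :
    limitRate c mu (n + 1) = summandRate (2 * c / mu) 1 n := by
  simp only [limitRate, summandRate, qnum_one_left]
  push_cast
  ring

lemma densityTerm_succ (c mu x : ℝ) (n : ℕ) :
    densityTerm c mu x (n + 1) = mixtureTerm (2 * c / mu) 1 x n := by
  simp only [densityTerm, mixtureTerm, limitRate_succ, limitWeight, qnum_one_left, one_pow]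
  push_cast
  ring

lemma limitDensity_eq (c mu x : ℝ) : limitDensity c mu x = mixtureDensity (2 * c / mu) 1 x := by
  simp only [limitDensity, mixtureDensity, densityTerm_succ]

lemma tendsto_div_one_sub : Tendsto (fun rho : ℝ => rho / (1 - rho)) (𝓝[<] (1 / 2)) (𝓝 1) := by
  have h : ContinuousAt (fun rho : ℝ => rho / (1 - rho)) (1 / 2) :=
    continuousAt_id.div (by fun_prop) (by norm_num)
  have h2 := h.tendsto
  norm_num at h2
  exact h2.mono_left (by norm_num [nhdsWithin_le_nhds])

lemma eventually_div_one_sub :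
    ∀ᶠ rho : ℝ in 𝓝[<] (1 / 2), 0 < rho / (1 - rho) ∧ rho / (1 - rho) ≤ 1 := by
  filter_upwards [Ioo_mem_nhdsLT (show (0 : ℝ) < 1 / 2 by norm_num)] with rho h
  have : 0 < 1 - rho := by linarith [h.2]
  exact ⟨div_pos h.1 this, (div_le_one this).2 (by linarith [h.2])⟩

end FluidPolling

end

theorem lemma4p4 (c mu : ℝ) (hc : 0 < c) (hmu : 0 < mu)
    (V : ℝ → Measure (ℝ × ℝ))
    (hV : ∀ rho ∈ Ioo (0 : ℝ) (1 / 2),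
      FluidPolling.IsStationaryWorkloadLaw c (rho * mu) mu (V rho)) :
    -- the series converges
    (∀ x : ℝ, 0 < x → Summable fun n : ℕ => FluidPolling.densityTerm c mu x (n + 1)) ∧
    -- the densities of the scaled total workload converge pointwise to its sum
    (∃ f : ℝ → ℝ → ℝ,
      (∀ rho ∈ Ioo (0 : ℝ) (1 / 2),
        (∀ x, 0 ≤ f rho x) ∧ ContinuousOn (f rho) (Ioi 0) ∧
        FluidPolling.scaledTotalLaw rho (V rho) =
          volume.withDensity fun x => ENNReal.ofReal (f rho x)) ∧
      ∀ x : ℝ, 0 < x →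
        Tendsto (fun rho => f rho x) (𝓝[<] (1 / 2)) (𝓝 (FluidPolling.limitDensity c mu x))) ∧
    -- the limiting distribution
    ∃ L : Measure ℝ, IsProbabilityMeasure L ∧
      (∀ g : BoundedContinuousFunction ℝ ℝ,
        Tendsto (fun rho => ∫ x, g x ∂(FluidPolling.scaledTotalLaw rho (V rho)))
          (𝓝[<] (1 / 2)) (𝓝 (∫ x, g x ∂L))) ∧
      (∀ x : ℝ, 0 < x → 0 ≤ FluidPolling.limitDensity c mu x) ∧
      L = (volume.restrict (Ioi 0)).withDensity
        (fun x => ENNReal.ofReal (FluidPolling.limitDensity c mu x)) ∧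
      FluidPolling.IsInfinitelyDivisible L ∧
      ∀ (Ω : Type*) (_ : MeasurableSpace Ω) (P : Measure Ω) (E : ℕ → Ω → ℝ),
        IsProbabilityMeasure P → iIndepFun E P → (∀ n, HasLaw (E n) (expMeasure 1) P) →
        (∀ᵐ ω ∂P, Summable fun n : ℕ => E n ω / FluidPolling.limitRate c mu (n + 1)) ∧
        HasLaw (fun ω => ∑' n : ℕ, E n ω / FluidPolling.limitRate c mu (n + 1)) L P := by
  have hC : 0 < 2 * c / mu := by positivity
  have hr := summandRate_pos hC one_pos
  have hs := summable_inv_summandRate hC one_pos le_rfl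
  -- The density is set to `0` off the open half line, where the mixture series is not controlled.
  refine ⟨fun x hx => ?_, ⟨fun rho => (Ioi 0).indicator
    (mixtureDensity (2 * c / mu) (rho / (1 - rho))), fun rho hrho => ?_, fun x hx => ?_⟩,
    gammaSeriesLaw 1 (summandRate (2 * c / mu) 1), isProbabilityMeasure_gammaSeriesLaw one_pos hr hs,
    fun g => ?_, fun x hx => ?_, ?_, gammaSeriesLaw_infinitelyDivisible hr hs, ?_⟩
  · simp_rw [FluidPolling.densityTerm_succ]
    exact summable_mixtureTerm hC one_pos le_rfl hx
  · have hr1 : 0 < 1 - rho := by linarith [hrho.2]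
    have hq : 0 < rho / (1 - rho) := div_pos hrho.1 hr1
    have hq1 : rho / (1 - rho) ≤ 1 := (div_le_one hr1).2 (by linarith [hrho.2])
    refine ⟨indicator_nonneg fun x hx => mixtureDensity_nonneg hC hq hq1 hx,
      (continuousOn_mixtureDensity hC hq hq1).congr fun x hx => indicator_of_mem hx _, ?_⟩
    rw [(hV rho hrho).scaledTotalLaw_eq hc hmu hrho, gammaSeriesLaw_eq_withDensity hC hq hq1,
      ← withDensity_indicator measurableSet_Ioi]
    congr 1; funext x
    by_cases hx : x ∈ Ioi (0 : ℝ)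
    · simp only [indicator_of_mem hx]
    · simp only [indicator_of_notMem hx, ENNReal.ofReal_zero]
  · rw [FluidPolling.limitDensity_eq]
    simp only [indicator_of_mem (show x ∈ Ioi (0 : ℝ) from hx)]
    exact tendsto_mixtureDensity hC hx FluidPolling.eventually_div_one_sub
      FluidPolling.tendsto_div_one_sub
  · refine Tendsto.congr' (f₁ := fun rho =>
      ∫ x, g x ∂gammaSeriesLaw 1 (summandRate (2 * c / mu) (rho / (1 - rho)))) ?_ ?_
    · filter_upwards [Ioo_mem_nhdsLT (show (0 : ℝ) < 1 / 2 by norm_num)] with rho hrho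
      rw [(hV rho hrho).scaledTotalLaw_eq hc hmu hrho]
    -- These lower bounds hold for the rates at every `q` in `(0, 1]`, including the limiting ones.
    · refine tendsto_integral_gammaSeriesLaw one_pos
        (b := fun n => 2 * c / mu * ((n : ℝ) + 1) ^ 2) (fun n => by positivity)
        (summable_inv_mul_add_one_sq _) ?_ (le_summandRate hC one_pos le_rfl)
        (fun n => tendsto_summandRate FluidPolling.tendsto_div_one_sub n) g
      filter_upwards [FluidPolling.eventually_div_one_sub] with rho h
      exact le_summandRate hC h.1 h.2
  · rw [FluidPolling.limitDensity_eq]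
    exact mixtureDensity_nonneg hC one_pos le_rfl hx
  · simp_rw [FluidPolling.limitDensity_eq]
    exact gammaSeriesLaw_eq_withDensity hC one_pos le_rfl
  · intro Ω _ P E _ hind hE
    simp_rw [FluidPolling.limitRate_succ]
    exact ⟨ae_summable_div_of_hasLaw_gamma one_pos hE hr hs,
      hasLaw_tsum_div_gammaSeriesLaw one_pos hind hE hr hs⟩
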